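/- All algebras are associative unital $\mathbf C$-algebras. For an algebra $R$ let $R^{\rm Lie}_1=R$ and $R^{\rm Lie}_{i+1}=[R,R^{\rm Lie}_i]$ be the lower central series for the bracket $[a,b]=ab-ba$, let $$F^dR=\sum_{m}\ \sum_{i_1+\dots+i_m-m=d} R\cdot R^{\rm Lie}_{i_1}\cdot R\cdots R\cdot R^{\rm Lie}_{i_m}\cdot R$$ be the NC-filtration (a decreasing filtration by two-sided ideals), and let $R_{ab}=R/F^1R$ be the commutativization. Let $\mathcal N_d$ be the category of algebras $\Lambda$ with $F^{d+1}\Lambda=0$. An algebra $R$ is called *$d$-smooth* ($d\ge 0$) if it is finitely generated, $R\in\mathcal N_d$, and for every surjection $\Lambda'\to\Lambda$ in $\mathcal N_d$ with nilpotent kernel the map $\mathrm{Hom}(R,\Lambda')\to\mathrm{Hom}(R,\Lambda)$ is surjective. It is called *NC-smooth* if $R\to\varprojlim_d R/F^dR$ is an isomorphism and $R/F^{d+1}R$ is $d$-smooth for every $d\ge 0$. A *$d$-smooth* (resp. *NC-smooth*) *thickening* of a commutative algebra $A$ is a $d$-smooth (resp. NC-smooth) algebra $R$ together with an isomorphism $R_{ab}\to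 A$. **Theorem.** Let $A$ be a finitely generated smooth commutative $\mathbf C$-algebra. (a) For every $d\ge 0$, $A$ has a $d$-smooth thickening, and for any two $d$-smooth thickenings $R,R'$ of $A$ there is an algebra isomorphism $R\to R'$ compatible with the projections $R\to R_{ab}\cong A$ and $R'\to R'_{ab}\cong A$. (b) $A$ has an NC-smooth thickening, and for any two NC-smooth thickenings $R,R'$ of $A$ there is an algebra isomorphism $R\to R'$ compatible with the projections to $A$. (c) Let $d\ge0$, let $R$ be any $d$-smooth algebra and let $H=H_2(R,R_{ab})$ be the Hochschild homology, an $R_{ab}$-module. Then $R$ has a universal central extension, that is, a central extension $0\to H\to R^\tau\to R\to 0$ (in which $R^\tau$ acts on $H$ from both sides through $R^\tau\to R\to R_{ab}$) whose class in $H^2(R,H)$ is the tautological one: for a $\mathbf C$-linear section $s$ and the cocycle $c(x,y)=s(x)s(y)-s(xy)\in H$, the map $H_2(R,R_{ab})\to H$ induced by $a\otimes x\otimes y\mapsto a\,c(x,y)$ is the identity. For every universal central extension $R^\tau\to R$, the algebra $R^\tau$ is $(d+1)$-smooth, and $R^\tau\to R$ induces an isomorphism $R^\tau_{ab}\to R_{ab}$.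 In particular, if $R$ is a $d$-smooth thickening of $A$, then $R^\tau$ is a $(d+1)$-smooth thickening of $A$. -/

import Mathlib

open scoped TensorProduct

universe u

section NCFiltration

variable (R : Type u) [Ring R] [Algebra ℂ R]

attribute [local instance] LieRing.ofAssociativeRing

/-- `lieLower R k` is the term with `k` brackets of the lower central series of the Lie algebra
`(R, [a, b] = ab - ba)`; it is spanned by the iterated commutators
`[x₁, [x₂, … [xₖ, xₖ₊₁]…]]`. So `lieLower R 0 = R`. -/
def lieLower (k : ℕ) : Submodule ℂ R :=
  (LieModule.lowerCentralSeries ℂ R R k).toSubmodule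

theorem lieLower_zero : lieLower R 0 = ⊤ := by
  simp [lieLower]

theorem lieLower_succ_le (k : ℕ) : lieLower R (k + 1) ≤ lieLower R k :=
  LieModule.antitone_lowerCentralSeries ℂ R R (Nat.le_succ k)

theorem commutator_mem_lieLower_one (x y : R) : x * y - y * x ∈ lieLower R 1 := by
  have h : ⁅x, y⁆ ∈ LieModule.lowerCentralSeries ℂ R R 1 := by
    rw [LieModule.lowerCentralSeries_succ]
    exact LieSubmodule.lie_mem_lie (LieSubmodule.mem_top x) (by simp)
  exact h

/-- For a list `[k₁, …, kₘ]`, the span of all products in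
`R · L_{k₁} · R · L_{k₂} · R ⋯ R · L_{kₘ} · R`, where `L_k` is `lieLower R k`. -/
def ncProduct (l : List ℕ) : Submodule ℂ R :=
  ⊤ * (l.map fun k => lieLower R k * ⊤).prod

/-- The `d`-th term of the NC-filtration as a linear subspace: the sum of all
`R · L_{k₁} · R ⋯ R · L_{kₘ} · R` with `d` commutator brackets in total. -/
def ncFiltrationSubmodule (d : ℕ) : Submodule ℂ R :=
  ⨆ l : {l : List ℕ // l.sum = d}, ncProduct R l.1

theorem top_mul_top : (⊤ : Submodule ℂ R) * ⊤ = ⊤ :=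
  top_le_iff.1 fun x _ => by
    simpa using Submodule.mul_mem_mul (Submodule.mem_top (x := x) (R := ℂ))
      (Submodule.mem_top (x := (1 : R)) (R := ℂ))

theorem top_mul_ncProduct (l : List ℕ) : ⊤ * ncProduct R l = ncProduct R l := by
  rw [ncProduct, ← mul_assoc, top_mul_top]

theorem ncProduct_mul_top (l : List ℕ) : ncProduct R l * ⊤ = ncProduct R l := by
  induction l using List.reverseRecOn with
  | nil => simp [ncProduct, top_mul_top]
  | append_singleton l k _ => simp [ncProduct, mul_assoc, top_mul_top]

/-- The NC-filtration `F^d R` of an associative algebra, a decreasing sequence of two-sided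
ideals. -/
def ncFiltration (d : ℕ) : Ideal R where
  carrier := ncFiltrationSubmodule R d
  add_mem' := (ncFiltrationSubmodule R d).add_mem
  zero_mem' := (ncFiltrationSubmodule R d).zero_mem
  smul_mem' := fun c x hx => by
    have h : ⊤ * ncFiltrationSubmodule R d ≤ ncFiltrationSubmodule R d := by
      simp only [ncFiltrationSubmodule, Submodule.mul_iSup, top_mul_ncProduct, le_refl]
    exact h (Submodule.mul_mem_mul (Submodule.mem_top (x := c)) hx)

instance ncFiltration_isTwoSided (d : ℕ) : (ncFiltration R d).IsTwoSided where
  mul_mem_of_left := fun {a} b ha => by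
    have h : ncFiltrationSubmodule R d * ⊤ ≤ ncFiltrationSubmodule R d := by
      simp only [ncFiltrationSubmodule, Submodule.iSup_mul, ncProduct_mul_top, le_refl]
    exact h (Submodule.mul_mem_mul ha (Submodule.mem_top (x := b)))

theorem exists_ncProduct_le (l : List ℕ) (d : ℕ) (h : l.sum = d + 1) :
    ∃ l' : List ℕ, l'.sum = d ∧ ncProduct R l ≤ ncProduct R l' := by
  suffices H : ∀ (l : List ℕ) (d : ℕ), l.sum = d + 1 → ∃ l' : List ℕ, l'.sum = d ∧
      (l.map fun k => lieLower R k * ⊤).prod ≤ (l'.map fun k => lieLower R k * ⊤).prod by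
    obtain ⟨l', h1, h2⟩ := H l d h
    exact ⟨l', h1, mul_le_mul' le_rfl h2⟩
  intro l
  induction l with
  | nil => intro d h; simp at h
  | cons k l ih =>
    intro d h
    rcases k with _ | k
    · obtain ⟨l', h1, h2⟩ := ih d (by simpa using h)
      refine ⟨0 :: l', by simpa using h1, ?_⟩
      simp only [List.map_cons, List.prod_cons]
      exact mul_le_mul' le_rfl h2
    · refine ⟨k :: l, by simp at h ⊢; omega, ?_⟩
      simp only [List.map_cons, List.prod_cons]
      exact mul_le_mul'
        (mul_le_mul' (lieLower_succ_le R k) le_rfl) le_rfl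

theorem ncFiltration_succ_le (d : ℕ) : ncFiltration R (d + 1) ≤ ncFiltration R d := by
  have h : ncFiltrationSubmodule R (d + 1) ≤ ncFiltrationSubmodule R d := by
    refine iSup_le fun l => ?_
    obtain ⟨l', h1, h2⟩ := exists_ncProduct_le R l.1 d l.2
    exact h2.trans (le_iSup (fun l : {l : List ℕ // l.sum = d} => ncProduct R l.1) ⟨l', h1⟩)
  exact h

theorem commutator_mem_ncFiltration_one (x y : R) : x * y - y * x ∈ ncFiltration R 1 := by
  have h : ncProduct R [1] ≤ ncFiltrationSubmodule R 1 :=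
    le_iSup (fun l : {l : List ℕ // l.sum = 1} => ncProduct R l.1) ⟨[1], rfl⟩
  refine h ?_
  have := Submodule.mul_mem_mul (Submodule.mem_top (x := (1 : R)) (R := ℂ))
    (Submodule.mul_mem_mul (commutator_mem_lieLower_one R x y)
      (Submodule.mem_top (x := (1 : R)) (R := ℂ)))
  simpa [ncProduct] using this

end NCFiltration

section Abelianization

variable (R : Type u) [Ring R] [Algebra ℂ R]

/-- The commutativization `R_ab = R / F¹R`, the quotient by the two-sided ideal generated by
all commutators. -/
def NCAb : Type u := R ⧸ ncFiltration R 1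

instance NCAb.instRing : Ring (NCAb R) :=
  inferInstanceAs (Ring (R ⧸ ncFiltration R 1))

instance NCAb.instCommRing : CommRing (NCAb R) :=
  { NCAb.instRing R with
    mul_comm := by
      intro a b
      obtain ⟨x, rfl⟩ := Ideal.Quotient.mk_surjective (I := ncFiltration R 1) a
      obtain ⟨y, rfl⟩ := Ideal.Quotient.mk_surjective (I := ncFiltration R 1) b
      exact Ideal.Quotient.eq.2 (commutator_mem_ncFiltration_one R x y) }

instance NCAb.instAlgebra : Algebra ℂ (NCAb R) :=
  inferInstanceAs (Algebra ℂ (R ⧸ ncFiltration R 1))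

/-- The canonical surjection `R → R_ab`. -/
def NCAb.mk : R →ₐ[ℂ] NCAb R := Ideal.Quotient.mkₐ ℂ (ncFiltration R 1)

end Abelianization

section Smoothness

/-- `R` is NC-nilpotent of degree `d`: `F^{d+1} R = 0`. -/
def IsNCNilpotent (d : ℕ) (R : Type u) [Ring R] [Algebra ℂ R] : Prop :=
  ncFiltration R (d + 1) = ⊥

/-- `Λ ↦ Hom(R, Λ)`, restricted to the algebras that are NC-nilpotent of degree `d`, is formally
smooth: homomorphisms from `R` lift along surjections with nilpotent kernel. -/
def IsFormallyNCSmooth (d : ℕ) (R : Type u) [Ring R] [Algebra ℂ R] : Prop :=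
  ∀ (Λ' Λ : Type u) [Ring Λ'] [Algebra ℂ Λ'] [Ring Λ] [Algebra ℂ Λ],
    IsNCNilpotent d Λ' → IsNCNilpotent d Λ →
    ∀ p : Λ' →ₐ[ℂ] Λ, Function.Surjective p → IsNilpotent (RingHom.ker p) →
    ∀ f : R →ₐ[ℂ] Λ, ∃ g : R →ₐ[ℂ] Λ', p.comp g = f

/-- `d`-smooth algebras. -/
structure IsDSmooth (d : ℕ) (R : Type u) [Ring R] [Algebra ℂ R] : Prop where
  finiteType : Algebra.FiniteType ℂ R
  ncNilpotent : IsNCNilpotent d R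
  formallySmooth : IsFormallyNCSmooth d R

variable (R : Type u) [Ring R] [Algebra ℂ R]

/-- The NC-completion: the inverse limit of the algebras `R / F^d R`. -/
def NCCompletion : Subalgebra ℂ (∀ d : ℕ, R ⧸ ncFiltration R d) where
  carrier := {x | ∀ d, Ideal.Quotient.factorₐ ℂ (ncFiltration_succ_le R d) (x (d + 1)) = x d}
  mul_mem' := fun hx hy d => by
    rw [Pi.mul_apply, map_mul, hx d, hy d, Pi.mul_apply]
  add_mem' := fun hx hy d => by
    rw [Pi.add_apply, map_add, hx d, hy d, Pi.add_apply]
  algebraMap_mem' := fun c d => by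
    rw [Pi.algebraMap_apply, AlgHom.commutes, Pi.algebraMap_apply]

/-- The natural homomorphism `R → lim R / F^d R`. -/
def toNCCompletion : R →ₐ[ℂ] NCCompletion R :=
  (AlgHom.pi fun d => Ideal.Quotient.mkₐ ℂ (ncFiltration R d)).codRestrict
    (NCCompletion R) fun _ _ => rfl

/-- `R` is NC-complete: `R → lim R / F^d R` is an isomorphism. -/
def IsNCComplete : Prop := Function.Bijective (toNCCompletion R)

/-- NC-smooth algebras. -/
structure IsNCSmooth : Prop where
  ncComplete : IsNCComplete R
  quotient_dSmooth : ∀ d : ℕ, IsDSmooth d (R ⧸ ncFiltration R (d + 1))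

/-- A `d`-smooth thickening of a commutative algebra `A`: a `d`-smooth algebra `R` together with
an isomorphism `R_ab → A`. -/
structure DSmoothThickening (d : ℕ) (A : Type u) [CommRing A] [Algebra ℂ A]
    (R : Type u) [Ring R] [Algebra ℂ R] where
  dSmooth : IsDSmooth d R
  iso : NCAb R ≃ₐ[ℂ] A

/-- An NC-smooth thickening of a commutative algebra `A`: an NC-smooth algebra `R` together with
an isomorphism `R_ab → A`. -/
structure NCSmoothThickening (A : Type u) [CommRing A] [Algebra ℂ A]
    (R : Type u) [Ring R] [Algebra ℂ R] where
  ncSmooth : IsNCSmooth R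
  iso : NCAb R ≃ₐ[ℂ] A

end Smoothness

noncomputable section Hochschild

variable (R : Type u) [Ring R] [Algebra ℂ R]

/-- The boundary `C₂(R, R_ab) → C₁(R, R_ab)` of the Hochschild complex,
`a ⊗ x ⊗ y ↦ a x ⊗ y - a ⊗ x y + y a ⊗ x`, linear over `R_ab`. -/
def hochschildBoundaryTwo :
    NCAb R ⊗[ℂ] (R ⊗[ℂ] R) →ₗ[NCAb R] NCAb R ⊗[ℂ] R :=
  LinearMap.liftBaseChange (NCAb R)
    (TensorProduct.map (NCAb.mk R).toLinearMap LinearMap.id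
      - TensorProduct.mk ℂ (NCAb R) R 1 ∘ₗ LinearMap.mul' ℂ R
      + TensorProduct.map (NCAb.mk R).toLinearMap LinearMap.id ∘ₗ
          (TensorProduct.comm ℂ R R).toLinearMap)

theorem hochschildBoundaryTwo_tmul (a : NCAb R) (x y : R) :
    hochschildBoundaryTwo R (a ⊗ₜ (x ⊗ₜ y)) =
      (a * NCAb.mk R x) ⊗ₜ y - a ⊗ₜ (x * y) + (NCAb.mk R y * a) ⊗ₜ x := by
  simp [hochschildBoundaryTwo, TensorProduct.smul_tmul', mul_comm]

/-- The boundary `C₃(R, R_ab) → C₂(R, R_ab)` of the Hochschild complex,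
`a ⊗ x ⊗ y ⊗ z ↦ a x ⊗ y ⊗ z - a ⊗ x y ⊗ z + a ⊗ x ⊗ y z - z a ⊗ x ⊗ y`,
linear over `R_ab`. -/
def hochschildBoundaryThree :
    NCAb R ⊗[ℂ] (R ⊗[ℂ] (R ⊗[ℂ] R)) →ₗ[NCAb R] NCAb R ⊗[ℂ] (R ⊗[ℂ] R) :=
  LinearMap.liftBaseChange (NCAb R)
    (TensorProduct.map (NCAb.mk R).toLinearMap LinearMap.id
      - TensorProduct.mk ℂ (NCAb R) (R ⊗[ℂ] R) 1 ∘ₗ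
          TensorProduct.map (LinearMap.mul' ℂ R) LinearMap.id ∘ₗ
          (TensorProduct.assoc ℂ R R R).symm.toLinearMap
      + TensorProduct.mk ℂ (NCAb R) (R ⊗[ℂ] R) 1 ∘ₗ
          TensorProduct.map LinearMap.id (LinearMap.mul' ℂ R)
      - TensorProduct.map (NCAb.mk R).toLinearMap LinearMap.id ∘ₗ
          (TensorProduct.comm ℂ (R ⊗[ℂ] R) R).toLinearMap ∘ₗ
          (TensorProduct.assoc ℂ R R R).symm.toLinearMap)

theorem hochschildBoundaryThree_tmul (a : NCAb R) (x y z : R) :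
    hochschildBoundaryThree R (a ⊗ₜ (x ⊗ₜ (y ⊗ₜ z))) =
      (a * NCAb.mk R x) ⊗ₜ (y ⊗ₜ z) - a ⊗ₜ ((x * y) ⊗ₜ z) + a ⊗ₜ (x ⊗ₜ (y * z))
        - (NCAb.mk R z * a) ⊗ₜ (x ⊗ₜ y) := by
  simp [hochschildBoundaryThree, smul_add, smul_sub, TensorProduct.smul_tmul', mul_comm]

theorem hochschildBoundaryTwo_boundaryThree (w : NCAb R ⊗[ℂ] (R ⊗[ℂ] (R ⊗[ℂ] R))) :
    hochschildBoundaryTwo R (hochschildBoundaryThree R w) = 0 := by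
  induction w using TensorProduct.induction_on with
  | zero => simp
  | add w₁ w₂ h₁ h₂ => simp [h₁, h₂]
  | tmul a w =>
    induction w using TensorProduct.induction_on with
    | zero => simp
    | add w₁ w₂ h₁ h₂ => simp [TensorProduct.tmul_add, h₁, h₂]
    | tmul x w =>
      induction w using TensorProduct.induction_on with
      | zero => simp
      | add w₁ w₂ h₁ h₂ => simp [TensorProduct.tmul_add, h₁, h₂]
      | tmul y z =>
        simp only [hochschildBoundaryThree_tmul, map_sub, map_add, hochschildBoundaryTwo_tmul,
          map_mul, mul_assoc]
        rw [mul_comm (NCAb.mk R z) a]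
        abel

/-- Hochschild homology `H₂(R, R_ab) = Z₂ / B₂`, a module over `R_ab`, realized as the image of the
2-cycles `Z₂` in the quotient `C₂ / B₂` of the 2-chains by the 2-boundaries. -/
abbrev HochschildH2 : Type u :=
  (LinearMap.ker (hochschildBoundaryTwo R)).map (LinearMap.range (hochschildBoundaryThree R)).mkQ

variable {R} in
/-- The class in `H₂(R, R_ab)` of a Hochschild 2-cycle. -/
def HochschildH2.mk (z : NCAb R ⊗[ℂ] (R ⊗[ℂ] R)) (hz : hochschildBoundaryTwo R z = 0) :
    HochschildH2 R :=
  ⟨(LinearMap.range (hochschildBoundaryThree R)).mkQ z, Submodule.mem_map_of_mem hz⟩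

variable {R}

/-- The pairing of a bilinear map `c : R × R → M` (a Hochschild 2-cochain) with 2-chains,
`a ⊗ x ⊗ y ↦ a • c(x, y)`. -/
def hochschildPairing {M : Type u} [AddCommGroup M] [Module ℂ M] [Module (NCAb R) M]
    [IsScalarTower ℂ (NCAb R) M] (c : R →ₗ[ℂ] R →ₗ[ℂ] M) :
    NCAb R ⊗[ℂ] (R ⊗[ℂ] R) →ₗ[NCAb R] M :=
  LinearMap.liftBaseChange (NCAb R) (TensorProduct.lift c)

variable (R)

/-- A central extension `0 → M → E → R → 0`, where the `R_ab`-module `M` is regarded as a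
bimodule over `R` with equal left and right actions. -/
structure CentralExtension (M : Type u) [AddCommGroup M] [Module ℂ M] [Module (NCAb R) M]
    (E : Type u) [Ring E] [Algebra ℂ E] where
  proj : E →ₐ[ℂ] R
  incl : M →ₗ[ℂ] E
  proj_surjective : Function.Surjective proj
  incl_injective : Function.Injective incl
  exact : ∀ e : E, proj e = 0 ↔ ∃ m : M, incl m = e
  mul_incl : ∀ (e : E) (m : M), e * incl m = incl (NCAb.mk R (proj e) • m)
  incl_mul : ∀ (e : E) (m : M), incl m * e = incl (NCAb.mk R (proj e) • m)

/-- A central extension of `R` by `H₂(R, R_ab)` is universal if its class in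
`H²(R, H₂(R, R_ab))` is the tautological one: for a linear section `s` and the cocycle `c` with
`s(x) s(y) = s(xy) + c(x, y)`, the homomorphism `H₂(R, R_ab) → H₂(R, R_ab)` given by pairing with
`c` is the identity. -/
def CentralExtension.IsUniversal {R : Type u} [Ring R] [Algebra ℂ R]
    {E : Type u} [Ring E] [Algebra ℂ E] (X : CentralExtension R (HochschildH2 R) E) : Prop :=
  ∃ (s : R →ₗ[ℂ] E) (c : R →ₗ[ℂ] R →ₗ[ℂ] HochschildH2 R),
    (∀ x, X.proj (s x) = x) ∧
    (∀ x y, s x * s y = s (x * y) + X.incl (c x y)) ∧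
    ∀ (z : NCAb R ⊗[ℂ] (R ⊗[ℂ] R)) (hz : hochschildBoundaryTwo R z = 0),
      hochschildPairing c z = HochschildH2.mk z hz

end Hochschild

/-!
The NC-filtration is the smallest multiplicative filtration that starts with the whole algebra and
whose degree every bracket raises by one, so containments between filtrations reduce to these
closure properties.

Let `R` be `d`-smooth. Then `R_ab` is formally smooth, so `Ω_{R_ab}` is projective. As `Ω_{R_ab}` is
the cokernel of the Hochschild boundary `C₂(R, R_ab) → C₁(R, R_ab)`, this boundary has a linear
splitting, which produces a 2-cocycle with tautological pairing and shows that cocycles with zero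
pairing are coboundaries. Hence a universal central extension `E` exists and maps to every central
extension of `R`. Modulo `F^{d+1}E` the extension splits, because `R` is `d`-smooth; so its
tautological class dies there, which means that its kernel lies in `F^{d+1}E`.

To lift `E → Λ` along a nilpotent extension `Λ' → Λ` of algebras with `F^{d+2} = 0`, lift it first
modulo `F^{d+1}` by the smoothness of `R`, then to `Λ'` by the universal property, as `F^{d+1}Λ'`
is a central kernel. The discrepancy is a derivation of `E_ab` with values in `F^{d+1}Λ`, which
lifts to `F^{d+1}Λ'` because `E_ab = R_ab` has projective differentials.

In the inverse limit of a tower of `d`-smooth thickenings, an element of the closure of `F^{n+1}`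
is approximated by sums of terms `[xᵢ, u]` and `[xᵢ, xⱼ] u` with `u` in the closure of `F^n`, for
finitely many topological generators `xᵢ`. Summing the successive approximations shows that
`F^{n+1}` is already closed. Uniqueness holds because an endomorphism congruent to the identity
modulo `F^1` is the identity on the associated graded, hence bijective when the filtration is
complete.
-/

section NCFiltrations

variable {R S : Type*} [Ring R] [Algebra ℂ R] [Ring S] [Algebra ℂ S]

theorem lieLower_succ_le_of_commutator_mem {k : ℕ} {N : Submodule ℂ R}
    (h : ∀ x : R, ∀ y ∈ lieLower R k, x * y - y * x ∈ N) : lieLower R (k + 1) ≤ N := by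
  let _ := LieRing.ofAssociativeRing (A := R)
  rw [lieLower, LieModule.lowerCentralSeries_succ, LieSubmodule.lieIdeal_oper_eq_linear_span',
    Submodule.span_le]
  rintro _ ⟨x, -, y, hy, rfl⟩
  exact h x y hy

theorem commutator_mem_lieLower_succ {k : ℕ} (x : R) {y : R} (hy : y ∈ lieLower R k) :
    x * y - y * x ∈ lieLower R (k + 1) := by
  let _ := LieRing.ofAssociativeRing (A := R)
  have h : ⁅x, y⁆ ∈ LieModule.lowerCentralSeries ℂ R R (k + 1) := by
    rw [LieModule.lowerCentralSeries_succ]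
    exact LieSubmodule.lie_mem_lie (LieSubmodule.mem_top x) hy
  exact h

theorem ncProduct_append (l l' : List ℕ) :
    ncProduct R (l ++ l') = ncProduct R l * ncProduct R l' := by
  calc ncProduct R (l ++ l')
      = ncProduct R l * (l'.map fun k => lieLower R k * ⊤).prod := by
        simp only [ncProduct, List.map_append, List.prod_append, mul_assoc]
    _ = ncProduct R l * ⊤ * (l'.map fun k => lieLower R k * ⊤).prod := by rw [ncProduct_mul_top]
    _ = ncProduct R l * ncProduct R l' := mul_assoc _ _ _

theorem ncProduct_append_singleton (l : List ℕ) (k : ℕ) :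
    ncProduct R (l ++ [k]) = ncProduct R l * lieLower R k * ⊤ := by
  simp [ncProduct, mul_assoc]

theorem ncProduct_le_ncFiltrationSubmodule (l : List ℕ) :
    ncProduct R l ≤ ncFiltrationSubmodule R l.sum :=
  le_iSup (fun l' : {l' : List ℕ // l'.sum = l.sum} => ncProduct R l'.1) ⟨l, rfl⟩

/-- A filtration by linear subspaces, starting with the whole algebra, is an NC-filtration if it is
multiplicative and the bracket with any element of the algebra raises the degree. The filtration
`ncFiltration R` is the smallest one. -/
structure IsNCFiltration (G : ℕ → Submodule ℂ R) : Prop where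
  zero : G 0 = ⊤
  mul_mem : ∀ ⦃i j : ℕ⦄ ⦃x y : R⦄, x ∈ G i → y ∈ G j → x * y ∈ G (i + j)
  commutator_mem : ∀ ⦃i : ℕ⦄ (x : R) ⦃y : R⦄, y ∈ G i → x * y - y * x ∈ G (i + 1)

namespace IsNCFiltration

variable {G : ℕ → Submodule ℂ R}

theorem lieLower_le (hG : IsNCFiltration G) (k : ℕ) : lieLower R k ≤ G k := by
  induction k with
  | zero => simp [hG.zero]
  | succ k ih =>
    exact lieLower_succ_le_of_commutator_mem fun x y hy => hG.commutator_mem x (ih hy)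

theorem ncProduct_le (hG : IsNCFiltration G) (l : List ℕ) : ncProduct R l ≤ G l.sum := by
  induction l using List.reverseRecOn with
  | nil => simp [hG.zero]
  | append_singleton l k ih =>
    rw [ncProduct_append_singleton, List.sum_append, List.sum_singleton]
    have hprod : ncProduct R l * lieLower R k ≤ G (l.sum + k) :=
      Submodule.mul_le.2 fun a ha b hb => hG.mul_mem (ih ha) (hG.lieLower_le k hb)
    exact Submodule.mul_le.2 fun y hy z _ =>
      hG.mul_mem (j := 0) (hprod hy) (hG.zero ▸ Submodule.mem_top)

theorem mem_of_mem_ncFiltration (hG : IsNCFiltration G) {d : ℕ} {x : R}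
    (hx : x ∈ ncFiltration R d) : x ∈ G d := by
  have h : ncFiltrationSubmodule R d ≤ G d := iSup_le fun ⟨l, hl⟩ => hl ▸ hG.ncProduct_le l
  exact h hx

theorem comap (f : S →ₐ[ℂ] R) (hG : IsNCFiltration G) :
    IsNCFiltration fun i => (G i).comap f.toLinearMap where
  zero := by simp [hG.zero]
  mul_mem i j x y hx hy := by simpa using hG.mul_mem hx hy
  commutator_mem i x y hy := by simpa using hG.commutator_mem (f x) hy

theorem map (f : R →ₐ[ℂ] S) (hf : Function.Surjective f) (hG : IsNCFiltration G) :
    IsNCFiltration fun i => (G i).map f.toLinearMap where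
  zero := by
    rw [hG.zero, Submodule.map_top]
    exact LinearMap.range_eq_top.2 hf
  mul_mem := by
    rintro i j _ _ ⟨x, hx, rfl⟩ ⟨y, hy, rfl⟩
    exact ⟨x * y, hG.mul_mem hx hy, map_mul f x y⟩
  commutator_mem := by
    rintro i y _ ⟨x, hx, rfl⟩
    obtain ⟨y, rfl⟩ := hf y
    exact ⟨_, hG.commutator_mem y hx, by simp⟩

end IsNCFiltration

theorem smul_mem_ncFiltration {d : ℕ} (c : ℂ) {x : R} (hx : x ∈ ncFiltration R d) :
    c • x ∈ ncFiltration R d :=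
  (ncFiltrationSubmodule R d).smul_mem c hx

theorem ncFiltration_antitone : Antitone (ncFiltration R) :=
  antitone_nat_of_succ_le (ncFiltration_succ_le R)

theorem ncFiltration_zero : ncFiltration R 0 = ⊤ := by
  refine top_le_iff.1 fun x _ => ?_
  exact ncProduct_le_ncFiltrationSubmodule [] (by simp [ncProduct])

theorem mem_ncFiltration_zero (x : R) : x ∈ ncFiltration R 0 := by
  rw [ncFiltration_zero]
  trivial

theorem mul_mem_ncFiltration {i j : ℕ} {x y : R} (hx : x ∈ ncFiltration R i)
    (hy : y ∈ ncFiltration R j) : x * y ∈ ncFiltration R (i + j) := by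
  have h : ncFiltrationSubmodule R i * ncFiltrationSubmodule R j ≤
      ncFiltrationSubmodule R (i + j) := by
    simp only [ncFiltrationSubmodule, Submodule.iSup_mul, Submodule.mul_iSup]
    refine iSup_le fun ⟨l, hl⟩ => iSup_le fun ⟨l', hl'⟩ => ?_
    subst hl hl'
    rw [← ncProduct_append, ← List.sum_append]
    exact ncProduct_le_ncFiltrationSubmodule _
  exact h (Submodule.mul_mem_mul hx hy)

theorem lieLower_le_ncFiltrationSubmodule (k : ℕ) : lieLower R k ≤ ncFiltrationSubmodule R k := by
  intro x hx
  have h := ncProduct_le_ncFiltrationSubmodule (R := R) [k]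
  rw [List.sum_singleton] at h
  refine h ?_
  have h1 : (1 : R) ∈ (⊤ : Submodule ℂ R) := Submodule.mem_top
  simpa [ncProduct] using Submodule.mul_mem_mul h1 (Submodule.mul_mem_mul hx h1)

theorem commutator_mem_of_mem_ncProduct (x : R) {l : List ℕ} {y : R} (hy : y ∈ ncProduct R l) :
    x * y - y * x ∈ ncFiltrationSubmodule R (l.sum + 1) := by
  let D : R →ₗ[ℂ] R := LinearMap.mulLeft ℂ x - LinearMap.mulRight ℂ x
  revert y
  change ncProduct R l ≤ (ncFiltrationSubmodule R (l.sum + 1)).comap D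
  induction l using List.reverseRecOn with
  | nil => exact fun y _ => commutator_mem_ncFiltration_one R x y
  | append_singleton l k ih =>
    rw [ncProduct_append_singleton, List.sum_append, List.sum_singleton]
    have hD (a b : R) : D (a * b) = D a * b + a * D b := by
      simp only [D, LinearMap.sub_apply, LinearMap.mulLeft_apply, LinearMap.mulRight_apply]
      noncomm_ring
    have hl : ∀ {p}, p ∈ ncProduct R l → p ∈ ncFiltration R l.sum :=
      fun hp => ncProduct_le_ncFiltrationSubmodule l hp
    have hk : ∀ {a}, a ∈ lieLower R k → a ∈ ncFiltration R k :=
      fun ha => lieLower_le_ncFiltrationSubmodule k ha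
    have hprod : ncProduct R l * lieLower R k ≤ ncFiltrationSubmodule R (l.sum + k) :=
      Submodule.mul_le.2 fun p hp a ha => mul_mem_ncFiltration (hl hp) (hk ha)
    have hDprod : ncProduct R l * lieLower R k ≤
        (ncFiltrationSubmodule R (l.sum + k + 1)).comap D := by
      refine Submodule.mul_le.2 fun p hp a ha => ?_
      rw [Submodule.mem_comap, hD]
      have hDa : D a ∈ ncFiltration R (k + 1) :=
        lieLower_le_ncFiltrationSubmodule (k + 1) (commutator_mem_lieLower_succ x ha)
      refine add_mem ?_ (mul_mem_ncFiltration (j := k + 1) (hl hp) hDa)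
      rw [add_right_comm]
      exact mul_mem_ncFiltration (ih hp) (hk ha)
    refine Submodule.mul_le.2 fun q hq b _ => ?_
    rw [Submodule.mem_comap, hD]
    exact add_mem (Ideal.mul_mem_right b (ncFiltration R _) (hDprod hq))
      (mul_mem_ncFiltration (hprod hq) (commutator_mem_ncFiltration_one R x b))

theorem commutator_mem_ncFiltration_succ {i : ℕ} (x : R) {y : R} (hy : y ∈ ncFiltration R i) :
    x * y - y * x ∈ ncFiltration R (i + 1) := by
  have h : ncFiltrationSubmodule R i ≤ (ncFiltrationSubmodule R (i + 1)).comap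
      (LinearMap.mulLeft ℂ x - LinearMap.mulRight ℂ x) :=
    iSup_le fun ⟨_, hl⟩ _ hy => hl ▸ commutator_mem_of_mem_ncProduct x hy
  exact h hy

theorem isNCFiltration_ncFiltrationSubmodule : IsNCFiltration (ncFiltrationSubmodule R) where
  zero := top_le_iff.1 fun x _ => mem_ncFiltration_zero x
  mul_mem _ _ _ _ hx hy := mul_mem_ncFiltration hx hy
  commutator_mem _ x _ hy := commutator_mem_ncFiltration_succ x hy

theorem map_mem_ncFiltration (f : R →ₐ[ℂ] S) {d : ℕ} {x : R} (hx : x ∈ ncFiltration R d) :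
    f x ∈ ncFiltration S d :=
  (isNCFiltration_ncFiltrationSubmodule.comap f).mem_of_mem_ncFiltration hx

theorem exists_mem_ncFiltration_of_surjective (f : R →ₐ[ℂ] S) (hf : Function.Surjective f) {d : ℕ}
    {y : S} (hy : y ∈ ncFiltration S d) : ∃ x ∈ ncFiltration R d, f x = y :=
  (isNCFiltration_ncFiltrationSubmodule.map f hf).mem_of_mem_ncFiltration hy

theorem commutator_mem_ncFiltration_add {i j : ℕ} {x y : R} (hx : x ∈ ncFiltration R i)
    (hy : y ∈ ncFiltration R j) : x * y - y * x ∈ ncFiltration R (i + j + 1) := by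
  let G : ℕ → Submodule ℂ R := fun i =>
    { carrier := {x | x ∈ ncFiltration R i ∧
        ∀ j, ∀ y ∈ ncFiltration R j, x * y - y * x ∈ ncFiltration R (i + j + 1)}
      add_mem' := fun {a b} ha hb => ⟨add_mem ha.1 hb.1, fun j y hy => by
        rw [add_mul, mul_add, add_sub_add_comm]
        exact add_mem (ha.2 j y hy) (hb.2 j y hy)⟩
      zero_mem' := ⟨zero_mem _, fun j y _ => by simp⟩
      smul_mem' := fun c a ha => ⟨smul_mem_ncFiltration c ha.1, fun j y hy => by
        simpa [smul_sub] using smul_mem_ncFiltration c (ha.2 j y hy)⟩ }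
  have hG : IsNCFiltration G :=
    { zero := top_le_iff.1 fun x _ => ⟨mem_ncFiltration_zero x, fun j y hy => by
        simpa using commutator_mem_ncFiltration_succ x hy⟩
      mul_mem := by
        rintro i j x y ⟨hx, hx'⟩ ⟨hy, hy'⟩
        refine ⟨mul_mem_ncFiltration hx hy, fun k z hz => ?_⟩
        have leibniz : x * y * z - z * (x * y) = x * (y * z - z * y) + (x * z - z * x) * y := by
          noncomm_ring
        rw [leibniz]
        refine add_mem ?_ ?_
        · exact (by omega : i + (j + k + 1) = i + j + k + 1) ▸ mul_mem_ncFiltration hx (hy' k z hz)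
        · exact (by omega : i + k + 1 + j = i + j + k + 1) ▸ mul_mem_ncFiltration (hx' k z hz) hy
      commutator_mem := by
        rintro i r x ⟨hx, hx'⟩
        refine ⟨commutator_mem_ncFiltration_succ r hx, fun k z hz => ?_⟩
        have jacobi : (r * x - x * r) * z - z * (r * x - x * r)
            = (r * (x * z - z * x) - (x * z - z * x) * r)
              - (x * (r * z - z * r) - (r * z - z * r) * x) := by
          noncomm_ring
        rw [jacobi, add_right_comm i 1 k]
        exact sub_mem (commutator_mem_ncFiltration_succ r (hx' k z hz))
          (hx' (k + 1) _ (commutator_mem_ncFiltration_succ r hz)) }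
  exact (hG.mem_of_mem_ncFiltration hx).2 j y hy

theorem ncFiltration_one_le {J : Ideal R} [J.IsTwoSided] (h : ∀ x y, x * y - y * x ∈ J) :
    ncFiltration R 1 ≤ J := by
  let G : ℕ → Submodule ℂ R
    | 0 => ⊤
    | _ + 1 => J.restrictScalars ℂ
  have hG : IsNCFiltration G :=
    { zero := rfl
      mul_mem := by
        rintro (_ | i) (_ | j) x y hx hy
        · trivial
        · rw [zero_add]
          exact J.mul_mem_left x hy
        · exact J.mul_mem_right y hx
        · exact J.mul_mem_left x hy
      commutator_mem := fun _ x y _ => h x y }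
  exact fun x hx => hG.mem_of_mem_ncFiltration hx

theorem mul_lieLower_mul_mem {n : ℕ} {N : Submodule ℂ R}
    (hcomm : ∀ x, ∀ u ∈ ncFiltration R n, x * u - u * x ∈ N)
    (hmul : ∀ u ∈ ncFiltration R n, ∀ v ∈ ncFiltration R 1, u * v ∈ N) {k i : ℕ} (hik : i + k = n)
    {p z : R} (hp : p ∈ ncFiltration R i) (hz : z ∈ lieLower R (k + 1)) (b : R) :
    p * z * b ∈ N := by
  induction k generalizing i p z b with
  | zero =>
    subst hik
    rw [mul_assoc]
    exact hmul p hp _ (Ideal.mul_mem_right b _ (lieLower_le_ncFiltrationSubmodule 1 hz))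
  | succ k ih =>
    have h : lieLower R (k + 1 + 1) ≤
        N.comap (LinearMap.mulRight ℂ b ∘ₗ LinearMap.mulLeft ℂ p) := by
      refine lieLower_succ_le_of_commutator_mem fun x l hl => ?_
      have hpl : p * l ∈ ncFiltration R n :=
        hik ▸ mul_mem_ncFiltration hp (lieLower_le_ncFiltrationSubmodule (k + 1) hl)
      have expand : p * (x * l - l * x) * b = (x * (p * l * b) - p * l * b * x)
          - p * l * (x * b - b * x) - (x * p - p * x) * l * b := by
        noncomm_ring
      change p * (x * l - l * x) * b ∈ N
      rw [expand]
      exact sub_mem (sub_mem (hcomm x _ (Ideal.mul_mem_right b _ hpl))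
        (hmul _ hpl _ (commutator_mem_ncFiltration_one R x b)))
        (ih (by omega) (commutator_mem_ncFiltration_succ x hp) hl b)
    exact h hz

theorem mem_of_mem_ncFiltration_succ {n : ℕ} {N : Submodule ℂ R}
    (hcomm : ∀ x, ∀ u ∈ ncFiltration R n, x * u - u * x ∈ N)
    (hmul : ∀ v ∈ ncFiltration R 1, ∀ u ∈ ncFiltration R n, v * u ∈ N) {x : R}
    (hx : x ∈ ncFiltration R (n + 1)) : x ∈ N := by
  have hmul' : ∀ u ∈ ncFiltration R n, ∀ v ∈ ncFiltration R 1, u * v ∈ N := fun u hu v hv => by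
    simpa using sub_mem (hmul v hv u hu) (hcomm v u hu)
  have hP (l : List ℕ) (hl : l.sum = n + 1) : ncProduct R l ≤ N := by
    induction l using List.reverseRecOn with
    | nil => simp at hl
    | append_singleton l k ih =>
      rw [List.sum_append, List.sum_singleton] at hl
      rw [ncProduct_append_singleton]
      rcases k with _ | k
      · rw [lieLower_zero, ncProduct_mul_top, ncProduct_mul_top]
        exact ih hl
      · refine Submodule.mul_le.2 fun y hy b _ => ?_
        have : ncProduct R l * lieLower R (k + 1) ≤ N.comap (LinearMap.mulRight ℂ b) :=
          Submodule.mul_le.2 fun p hp z hz => mul_lieLower_mul_mem hcomm hmul' (Nat.succ.inj hl)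
            (ncProduct_le_ncFiltrationSubmodule l hp) hz b
        exact this hy
  have h : ncFiltrationSubmodule R (n + 1) ≤ N := iSup_le fun l => hP l.1 l.2
  exact h hx

end NCFiltrations

section NilpotentIdeals

variable {R S : Type*} [Ring R] [Ring S]

theorem isNilpotent_of_le {I J : Ideal R} (hJI : J ≤ I) (hI : IsNilpotent I) : IsNilpotent J := by
  obtain ⟨n, hn⟩ := hI
  exact ⟨n, le_bot_iff.1 ((Ideal.pow_right_mono hJI n).trans hn.le)⟩

theorem map_pow_le_of_surjective {f : R →+* S} (hf : Function.Surjective f) (I : Ideal R) (n : ℕ) :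
    I.map f ^ n ≤ (I ^ n).map f := by
  induction n with
  | zero =>
    rw [Submodule.pow_zero, Submodule.pow_zero, Ideal.one_eq_top, Ideal.one_eq_top, Ideal.map_top]
  | succ n ih =>
    rw [Submodule.pow_succ, Submodule.pow_succ, Ideal.mul_le]
    intro x hx y hy
    obtain ⟨a, ha, rfl⟩ := (Ideal.mem_map_iff_of_surjective f hf).1 (ih hx)
    obtain ⟨b, hb, rfl⟩ := (Ideal.mem_map_iff_of_surjective f hf).1 hy
    rw [← map_mul]
    exact Ideal.mem_map_of_mem f (Ideal.mul_mem_mul ha hb)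

theorem isNilpotent_map_of_surjective {f : R →+* S} (hf : Function.Surjective f) {I : Ideal R}
    (hI : IsNilpotent I) : IsNilpotent (I.map f) := by
  obtain ⟨n, hn⟩ := hI
  refine ⟨n, le_bot_iff.1 ((map_pow_le_of_surjective hf I n).trans ?_)⟩
  rw [hn]
  exact Ideal.map_bot.le

end NilpotentIdeals

section NilpotentAlgebras

variable {R : Type u} [Ring R] [Algebra ℂ R]

theorem isNCNilpotent_iff {d : ℕ} :
    IsNCNilpotent d R ↔ ∀ x ∈ ncFiltration R (d + 1), x = 0 :=
  Submodule.eq_bot_iff _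

theorem IsNCNilpotent.eq_zero {d : ℕ} (h : IsNCNilpotent d R) {n : ℕ} (hn : d + 1 ≤ n) {x : R}
    (hx : x ∈ ncFiltration R n) : x = 0 :=
  isNCNilpotent_iff.1 h x (ncFiltration_antitone hn hx)

theorem IsNCNilpotent.mono {d n : ℕ} (h : IsNCNilpotent d R) (hn : d ≤ n) : IsNCNilpotent n R :=
  isNCNilpotent_iff.2 fun _ hx => h.eq_zero (Nat.succ_le_succ hn) hx

theorem isNCNilpotent_of_commRing (A : Type u) [CommRing A] [Algebra ℂ A] (d : ℕ) :
    IsNCNilpotent d A := by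
  have h : IsNCNilpotent 0 A :=
    le_bot_iff.1 (ncFiltration_one_le fun x y => by simp [mul_comm x y])
  exact h.mono (Nat.zero_le d)

theorem IsNCNilpotent.mul_comm (h : IsNCNilpotent 0 R) (x y : R) : x * y = y * x :=
  sub_eq_zero.1 (h.eq_zero le_rfl (commutator_mem_ncFiltration_one R x y))

theorem IsNCNilpotent.of_surjective {S : Type u} [Ring S] [Algebra ℂ S] {d : ℕ}
    (h : IsNCNilpotent d R) (f : R →ₐ[ℂ] S) (hf : Function.Surjective f) : IsNCNilpotent d S :=
  isNCNilpotent_iff.2 fun y hy => by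
    obtain ⟨x, hx, rfl⟩ := exists_mem_ncFiltration_of_surjective f hf hy
    rw [h.eq_zero le_rfl hx, map_zero]

theorem isNCNilpotent_quotient (d : ℕ) : IsNCNilpotent d (R ⧸ ncFiltration R (d + 1)) :=
  isNCNilpotent_iff.2 fun y hy => by
    obtain ⟨x, hx, rfl⟩ := exists_mem_ncFiltration_of_surjective
      (Ideal.Quotient.mkₐ ℂ (ncFiltration R (d + 1))) (Ideal.Quotient.mkₐ_surjective _ _) hy
    exact Ideal.Quotient.eq_zero_iff_mem.2 hx

theorem IsNCNilpotent.map_eq_zero {S : Type u} [Ring S] [Algebra ℂ S] {d : ℕ}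
    (h : IsNCNilpotent d S) (f : R →ₐ[ℂ] S) {x : R} (hx : x ∈ ncFiltration R (d + 1)) :
    f x = 0 :=
  h.eq_zero le_rfl (map_mem_ncFiltration f hx)

theorem ncFiltration_pow_le (n m : ℕ) : ncFiltration R n ^ m ≤ ncFiltration R (m * n) := by
  induction m with
  | zero => simp [ncFiltration_zero]
  | succ m ih =>
    rw [Submodule.pow_succ, add_mul, one_mul]
    exact Ideal.mul_le.2 fun r hr s hs => mul_mem_ncFiltration (ih hr) hs

theorem IsNCNilpotent.isNilpotent_ncFiltration_one {d : ℕ} (h : IsNCNilpotent d R) :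
    IsNilpotent (ncFiltration R 1) :=
  ⟨d + 1, (Submodule.eq_bot_iff _).2 fun _ hx =>
    h.eq_zero (mul_one (d + 1)).ge (ncFiltration_pow_le 1 (d + 1) hx)⟩

theorem IsNCNilpotent.isNilpotent_ker {S : Type*} [Ring S] [Algebra ℂ S] {d : ℕ}
    (h : IsNCNilpotent d R) (p : R →ₐ[ℂ] S) (hp : RingHom.ker p ≤ ncFiltration R 1) :
    IsNilpotent (RingHom.ker p) :=
  isNilpotent_of_le hp h.isNilpotent_ncFiltration_one

end NilpotentAlgebras

section Commutativization

variable {R S : Type u} [Ring R] [Algebra ℂ R] [Ring S] [Algebra ℂ S]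

theorem NCAb.mk_surjective : Function.Surjective (NCAb.mk R) :=
  Ideal.Quotient.mk_surjective (I := ncFiltration R 1)

theorem NCAb.mk_eq_zero {x : R} : NCAb.mk R x = 0 ↔ x ∈ ncFiltration R 1 :=
  Ideal.Quotient.eq_zero_iff_mem (I := ncFiltration R 1)

theorem NCAb.mk_eq_mk {x y : R} : NCAb.mk R x = NCAb.mk R y ↔ x - y ∈ ncFiltration R 1 := by
  rw [← NCAb.mk_eq_zero, map_sub, sub_eq_zero]

/-- The homomorphism induced on the commutativization by a homomorphism to a commutative
algebra. -/
def NCAb.lift {B : Type u} [CommRing B] [Algebra ℂ B] (f : R →ₐ[ℂ] B) : NCAb R →ₐ[ℂ] B :=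
  Ideal.Quotient.liftₐ (ncFiltration R 1) f fun _ hx =>
    (isNCNilpotent_of_commRing B 0).map_eq_zero f hx

/-- The functoriality of the commutativization. -/
def NCAb.map (f : R →ₐ[ℂ] S) : NCAb R →ₐ[ℂ] NCAb S :=
  NCAb.lift ((NCAb.mk S).comp f)

theorem NCAb.map_mk (f : R →ₐ[ℂ] S) (x : R) : NCAb.map f (NCAb.mk R x) = NCAb.mk S (f x) :=
  rfl

theorem NCAb.map_bijective (f : R →ₐ[ℂ] S) (hf : Function.Surjective f)
    (hker : RingHom.ker f ≤ ncFiltration R 1) : Function.Bijective (NCAb.map f) := by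
  refine ⟨(injective_iff_map_eq_zero _).2 fun y hy => ?_, fun y => ?_⟩
  · obtain ⟨x, rfl⟩ := NCAb.mk_surjective y
    obtain ⟨z, hz, hzx⟩ :=
      exists_mem_ncFiltration_of_surjective f hf
        (NCAb.mk_eq_zero.1 ((NCAb.map_mk f x).symm.trans hy))
    have hxz : x - z ∈ ncFiltration R 1 := hker (by rw [RingHom.mem_ker, map_sub, hzx, sub_self])
    rw [NCAb.mk_eq_mk.2 hxz, NCAb.mk_eq_zero.2 hz]
  · obtain ⟨x, rfl⟩ := NCAb.mk_surjective y
    obtain ⟨e, rfl⟩ := hf x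
    exact ⟨NCAb.mk R e, NCAb.map_mk f e⟩

theorem isNCFiltration_subalgebra_sup {B : Subalgebra ℂ R} (hB : B.map (NCAb.mk R) = ⊤) :
    IsNCFiltration fun n =>
      B.toSubmodule ⊓ ncFiltrationSubmodule R n ⊔ ncFiltrationSubmodule R (n + 1) := by
  have hB' (x : R) : ∃ b ∈ B, ∃ u ∈ ncFiltration R 1, b + u = x := by
    obtain ⟨b, hb, hbx⟩ : NCAb.mk R x ∈ B.map (NCAb.mk R) := hB ▸ Algebra.mem_top
    exact ⟨b, hb, x - b, NCAb.mk_eq_mk.1 hbx.symm, add_sub_cancel b x⟩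
  refine ⟨top_le_iff.1 fun x _ => ?_, fun i j x y hx hy => ?_, fun i x y hy => ?_⟩
  · obtain ⟨b, hb, u, hu, rfl⟩ := hB' x
    exact Submodule.add_mem_sup ⟨hb, mem_ncFiltration_zero b⟩ hu
  · obtain ⟨b, ⟨hb, hbi⟩, u, hu, rfl⟩ := Submodule.mem_sup.1 hx
    obtain ⟨c, ⟨hc, hcj⟩, v, hv, rfl⟩ := Submodule.mem_sup.1 hy
    have expand : (b + u) * (c + v) = b * c + (b * v + u * (c + v)) := by noncomm_ring
    rw [expand]
    refine Submodule.add_mem_sup ⟨B.mul_mem hb hc, mul_mem_ncFiltration hbi hcj⟩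
      (add_mem (mul_mem_ncFiltration (j := j + 1) hbi hv) ?_)
    rw [add_right_comm]
    exact mul_mem_ncFiltration hu (add_mem hcj (ncFiltration_antitone (Nat.le_succ j) hv))
  · obtain ⟨a, ha, t, ht, rfl⟩ := hB' x
    obtain ⟨b, ⟨hb, hbi⟩, u, hu, rfl⟩ := Submodule.mem_sup.1 hy
    have expand : (a + t) * (b + u) - (b + u) * (a + t) =
        (a * b - b * a) + ((t * b - b * t) + ((a + t) * u - u * (a + t))) := by noncomm_ring
    rw [expand]
    refine Submodule.add_mem_sup
      ⟨sub_mem (B.mul_mem ha hb) (B.mul_mem hb ha), commutator_mem_ncFiltration_succ a hbi⟩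
      (add_mem ?_ (commutator_mem_ncFiltration_succ (a + t) hu))
    rw [add_comm i 1]
    exact commutator_mem_ncFiltration_add ht hbi

theorem IsNCNilpotent.eq_top_of_map_mk_eq_top {d : ℕ} (h : IsNCNilpotent d R) {B : Subalgebra ℂ R}
    (hB : B.map (NCAb.mk R) = ⊤) : B = ⊤ := by
  have hsup (n : ℕ) : B.toSubmodule ⊔ ncFiltrationSubmodule R n = ⊤ := by
    induction n with
    | zero => rw [isNCFiltration_ncFiltrationSubmodule.zero, sup_top_eq]
    | succ n ih =>
      rw [← top_le_iff, ← ih]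
      refine sup_le le_sup_left fun x hx => ?_
      obtain ⟨b, hb, u, hu, rfl⟩ :=
        Submodule.mem_sup.1 ((isNCFiltration_subalgebra_sup hB).mem_of_mem_ncFiltration hx)
      exact Submodule.add_mem_sup hb.1 hu
  have hbot : ncFiltrationSubmodule R (d + 1) = ⊥ :=
    (Submodule.eq_bot_iff _).2 (isNCNilpotent_iff.1 h)
  rw [← Algebra.toSubmodule_eq_top, ← hsup (d + 1), hbot, sup_bot_eq]

theorem IsNCNilpotent.finiteType {d : ℕ} (h : IsNCNilpotent d R)
    (hab : Algebra.FiniteType ℂ (NCAb R)) : Algebra.FiniteType ℂ R := by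
  classical
  obtain ⟨s, hs⟩ := hab.out
  choose l hl using NCAb.mk_surjective (R := R)
  refine ⟨⟨s.image l, h.eq_top_of_map_mk_eq_top ?_⟩⟩
  rw [AlgHom.map_adjoin, Finset.coe_image, Set.image_image, Set.image_congr fun y _ => hl y,
    Set.image_id', hs]

end Commutativization

section SmoothAlgebras

variable {R : Type u} [Ring R] [Algebra ℂ R]

theorem IsDSmooth.of_equiv {d : ℕ} {S : Type u} [Ring S] [Algebra ℂ S] (e : R ≃ₐ[ℂ] S)
    (h : IsDSmooth d R) : IsDSmooth d S where
  finiteType := h.finiteType.equiv e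
  ncNilpotent := h.ncNilpotent.of_surjective e.toAlgHom e.surjective
  formallySmooth := fun Λ' Λ _ _ _ _ hΛ' hΛ p hp hk f => by
    obtain ⟨g, hg⟩ := h.formallySmooth Λ' Λ hΛ' hΛ p hp hk (f.comp e.toAlgHom)
    refine ⟨g.comp e.symm.toAlgHom, ?_⟩
    rw [← AlgHom.comp_assoc, hg]
    ext x
    simp

theorem IsDSmooth.quotient {d n : ℕ} (hn : n ≤ d) (h : IsDSmooth d R) :
    IsDSmooth n (R ⧸ ncFiltration R (n + 1)) where
  finiteType :=
    haveI := h.finiteType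
    Algebra.FiniteType.of_surjective (Ideal.Quotient.mkₐ ℂ _) (Ideal.Quotient.mkₐ_surjective _ _)
  ncNilpotent := isNCNilpotent_quotient n
  formallySmooth := fun Λ' Λ _ _ _ _ hΛ' hΛ p hp hk f => by
    obtain ⟨g, hg⟩ := h.formallySmooth Λ' Λ (hΛ'.mono hn) (hΛ.mono hn) p hp hk
      (f.comp (Ideal.Quotient.mkₐ ℂ _))
    refine ⟨Ideal.Quotient.liftₐ _ g fun a ha => hΛ'.map_eq_zero g ha, ?_⟩
    apply Ideal.Quotient.algHom_ext
    rw [AlgHom.comp_assoc, Ideal.Quotient.liftₐ_comp, hg]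

theorem isDSmooth_zero_of_smooth (A : Type u) [CommRing A] [Algebra ℂ A] [Algebra.Smooth ℂ A] :
    IsDSmooth 0 A where
  finiteType := inferInstance
  ncNilpotent := isNCNilpotent_of_commRing A 0
  formallySmooth := fun Λ' Λ _ _ _ _ hΛ' hΛ p hp hk f => by
    let _ : CommRing Λ' := { mul_comm := hΛ'.mul_comm }
    let _ : CommRing Λ := { mul_comm := hΛ.mul_comm }
    exact ⟨Algebra.FormallySmooth.liftOfSurjective f p hp hk,
      Algebra.FormallySmooth.comp_liftOfSurjective f p hp hk⟩

theorem IsFormallyNCSmooth.formallySmooth_ncAb {d : ℕ} (h : IsFormallyNCSmooth d R) :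
    Algebra.FormallySmooth ℂ (NCAb R) := by
  refine Algebra.FormallySmooth.of_comp_surjective fun B _ _ I hI f => ?_
  have hker : IsNilpotent (RingHom.ker (Ideal.Quotient.mkₐ ℂ I)) :=
    ⟨2, (Ideal.mk_ker (I := I)).symm ▸ hI⟩
  obtain ⟨g, hg⟩ := h B (B ⧸ I) (isNCNilpotent_of_commRing B d) (isNCNilpotent_of_commRing _ d)
    (Ideal.Quotient.mkₐ ℂ I) (Ideal.Quotient.mkₐ_surjective ℂ I) hker (f.comp (NCAb.mk R))
  refine ⟨NCAb.lift g, AlgHom.ext fun y => ?_⟩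
  obtain ⟨x, rfl⟩ := NCAb.mk_surjective y
  exact DFunLike.congr_fun hg x

theorem IsDSmooth.formallySmooth_ncAb {d : ℕ} (h : IsDSmooth d R) :
    Algebra.FormallySmooth ℂ (NCAb R) :=
  h.formallySmooth.formallySmooth_ncAb

end SmoothAlgebras

section CompleteFiltrations

variable {k M N : Type*} [Ring k] [AddCommGroup M] [Module k M] [AddCommGroup N] [Module k N]

/-- A decreasing filtration of a module is complete if it is separated and every sequence that is
Cauchy at the rate of the filtration has a limit. -/
structure IsCompleteFiltration (G : ℕ → Submodule k M) : Prop where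
  antitone : Antitone G
  eq_zero : ∀ x, (∀ n, x ∈ G n) → x = 0
  exists_limit : ∀ x : ℕ → M, (∀ n, x (n + 1) - x n ∈ G n) → ∃ y, ∀ n, y - x n ∈ G n

theorem sub_mem_of_forall_succ_sub_mem {G : ℕ → Submodule k M} (hG : Antitone G) {x : ℕ → M}
    (hx : ∀ n, x (n + 1) - x n ∈ G n) {m n : ℕ} (hmn : m ≤ n) : x n - x m ∈ G m := by
  induction n, hmn using Nat.le_induction with
  | base => simp
  | succ n hmn ih =>
    rw [← sub_add_sub_cancel _ (x n)]
    exact add_mem (hG hmn (hx n)) ih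

theorem IsCompleteFiltration.shift {G : ℕ → Submodule k M} (hG : IsCompleteFiltration G) (m : ℕ) :
    IsCompleteFiltration fun n => G (m + n) where
  antitone _ _ hij := hG.antitone (Nat.add_le_add_left hij m)
  eq_zero x hx := hG.eq_zero x fun n => hG.antitone (Nat.le_add_left n m) (hx n)
  exists_limit x hx := by
    obtain ⟨y, hy⟩ := hG.exists_limit (fun i => x (i - m)) fun i => by
      rcases lt_or_ge i m with him | him
      · simp [Nat.sub_eq_zero_of_le him, Nat.sub_eq_zero_of_le him.le]
      · obtain ⟨n, rfl⟩ := Nat.exists_eq_add_of_le him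
        simpa [add_assoc] using hx n
    exact ⟨y, fun n => by simpa using hy (m + n)⟩

theorem IsCompleteFiltration.pi {G : ℕ → Submodule k M} (hG : IsCompleteFiltration G)
    (ι : Type*) : IsCompleteFiltration fun n => Submodule.pi (Set.univ : Set ι) fun _ => G n where
  antitone _ _ hij _ hx i hi := hG.antitone hij (hx i hi)
  eq_zero x hx := funext fun i => hG.eq_zero (x i) fun n => hx n i trivial
  exists_limit x hx := by
    choose y hy using fun i => hG.exists_limit (fun n => x n i) fun n => hx n i trivial
    exact ⟨y, fun n i _ => hy i n⟩

theorem IsCompleteFiltration.exists_map_eq {P : ℕ → Submodule k N} {Q : ℕ → Submodule k M}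
    (hP : IsCompleteFiltration P) (hQ : ∀ y, (∀ n, y ∈ Q n) → y = 0) (L : N →ₗ[k] M)
    (hL : ∀ n, ∀ z ∈ P n, L z ∈ Q n)
    (happrox : ∀ n, ∀ y ∈ Q n, ∃ z ∈ P n, y - L z ∈ Q (n + 1)) {y : M} (hy : y ∈ Q 0) :
    ∃ z ∈ P 0, L z = y := by
  choose! a haP haQ using happrox
  let s : ℕ → N := fun n => Nat.rec 0 (fun n s => s + a n (y - L s)) n
  have hs (n : ℕ) : y - L (s n) ∈ Q n := by
    induction n with
    | zero => simpa [s] using hy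
    | succ n ih => simpa only [s, map_add, ← sub_sub] using haQ n _ ih
  obtain ⟨z, hz⟩ := hP.exists_limit s fun n => by simpa [s] using haP n _ (hs n)
  refine ⟨z, by simpa [s] using hz 0, (sub_eq_zero.1 (hQ _ fun n => ?_)).symm⟩
  have hsplit : y - L z = y - L (s n) - L (z - s n) := by rw [map_sub]; abel
  rw [hsplit]
  exact sub_mem (hs n) (hL n _ (hz n))

variable {R : Type u} [Ring R] [Algebra ℂ R]

theorem IsNCNilpotent.isCompleteFiltration {d : ℕ} (h : IsNCNilpotent d R) :
    IsCompleteFiltration (ncFiltrationSubmodule R) where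
  antitone := ncFiltration_antitone (R := R)
  eq_zero x hx := h.eq_zero le_rfl (hx (d + 1))
  exists_limit x hx := by
    have hcauchy {m n : ℕ} (hmn : m ≤ n) : x n - x m ∈ ncFiltration R m :=
      sub_mem_of_forall_succ_sub_mem (ncFiltration_antitone (R := R)) hx hmn
    refine ⟨x (d + 1), fun n => ?_⟩
    rcases le_total n (d + 1) with hn | hn
    · exact hcauchy hn
    · rw [← neg_sub, h.eq_zero le_rfl (hcauchy hn), neg_zero]
      exact zero_mem _

theorem toNCCompletion_apply (x : R) (n : ℕ) :
    (toNCCompletion R x).1 n = Ideal.Quotient.mk (ncFiltration R n) x :=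
  rfl

theorem isNCComplete_iff :
    IsNCComplete R ↔ IsCompleteFiltration (ncFiltrationSubmodule R) := by
  refine ⟨fun h => ⟨ncFiltration_antitone (R := R), fun x hx => ?_, fun x hx => ?_⟩,
    fun h => ⟨(injective_iff_map_eq_zero _).2 fun x hx => ?_, fun y => ?_⟩⟩
  · refine (injective_iff_map_eq_zero _).1 h.1 x (Subtype.ext (funext fun n => ?_))
    exact Ideal.Quotient.eq_zero_iff_mem.2 (hx n)
  · obtain ⟨y, hy⟩ := h.2 ⟨fun n => Ideal.Quotient.mk _ (x n), fun n => Ideal.Quotient.eq.2 (hx n)⟩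
    refine ⟨y, fun n => (Ideal.Quotient.eq (I := ncFiltration R n)).1 ?_⟩
    rw [← toNCCompletion_apply, hy]
  · refine h.eq_zero x fun n => (Ideal.Quotient.eq_zero_iff_mem (I := ncFiltration R n)).1 ?_
    rw [← toNCCompletion_apply, hx]
    rfl
  · choose l hl using fun n => Ideal.Quotient.mk_surjective (y.1 n)
    obtain ⟨x, hx⟩ := h.exists_limit l fun n =>
      (Ideal.Quotient.eq (I := ncFiltration R n)).1 <| by
        rw [hl n, ← y.2 n, ← hl (n + 1)]
        rfl
    refine ⟨x, Subtype.ext (funext fun n => ?_)⟩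
    rw [toNCCompletion_apply, ← hl n]
    exact Ideal.Quotient.eq.2 (hx n)

theorem map_sub_mem_ncFiltration_succ (e : R →ₐ[ℂ] R) (he : ∀ x, e x - x ∈ ncFiltration R 1)
    {n : ℕ} {x : R} (hx : x ∈ ncFiltration R n) : e x - x ∈ ncFiltration R (n + 1) := by
  have hG : IsNCFiltration fun i => ncFiltrationSubmodule R i ⊓
      (ncFiltrationSubmodule R (i + 1)).comap (e.toLinearMap - LinearMap.id) := by
    refine ⟨top_le_iff.1 fun x _ => ⟨mem_ncFiltration_zero x, he x⟩, ?_, ?_⟩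
    · rintro i j x y ⟨hx, hx' : e x - x ∈ ncFiltration R (i + 1)⟩
        ⟨hy, hy' : e y - y ∈ ncFiltration R (j + 1)⟩
      refine ⟨mul_mem_ncFiltration hx hy, ?_⟩
      change e (x * y) - x * y ∈ ncFiltration R (i + j + 1)
      have leibniz : e (x * y) - x * y = (e x - x) * e y + x * (e y - y) := by
        rw [map_mul]
        noncomm_ring
      rw [leibniz]
      refine add_mem ?_ (mul_mem_ncFiltration (j := j + 1) hx hy')
      rw [add_right_comm]
      exact mul_mem_ncFiltration hx' (map_mem_ncFiltration e hy)
    · rintro i r x ⟨hx, hx' : e x - x ∈ ncFiltration R (i + 1)⟩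
      refine ⟨commutator_mem_ncFiltration_succ r hx, ?_⟩
      change e (r * x - x * r) - (r * x - x * r) ∈ ncFiltration R (i + 1 + 1)
      have leibniz : e (r * x - x * r) - (r * x - x * r)
          = ((e r - r) * e x - e x * (e r - r)) + (r * (e x - x) - (e x - x) * r) := by
        rw [map_sub, map_mul, map_mul]
        noncomm_ring
      rw [leibniz]
      refine add_mem ?_ (commutator_mem_ncFiltration_succ r hx')
      rw [add_comm i 1]
      exact commutator_mem_ncFiltration_add (he r) (map_mem_ncFiltration e hx)
  exact (hG.mem_of_mem_ncFiltration hx).2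

theorem bijective_of_sub_mem_ncFiltration_one (h : IsCompleteFiltration (ncFiltrationSubmodule R))
    (e : R →ₐ[ℂ] R) (he : ∀ x, e x - x ∈ ncFiltration R 1) : Function.Bijective e := by
  refine ⟨(injective_iff_map_eq_zero e).2 fun x hx => h.eq_zero x fun n => ?_, fun y => ?_⟩
  · induction n with
    | zero => exact mem_ncFiltration_zero x
    | succ n ih =>
      have hneg : e x - x ∈ ncFiltration R (n + 1) := map_sub_mem_ncFiltration_succ e he ih
      rw [hx, zero_sub] at hneg
      exact neg_mem_iff.1 hneg
  · obtain ⟨z, -, hz⟩ := h.exists_map_eq h.eq_zero e.toLinearMap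
      (fun n z hz => map_mem_ncFiltration e hz)
      (fun n y hy => ⟨y, hy, by
        rw [← neg_sub]
        exact neg_mem (map_sub_mem_ncFiltration_succ e he hy)⟩)
      (mem_ncFiltration_zero y)
    exact ⟨z, hz⟩

end CompleteFiltrations

section Uniqueness

variable {A : Type u} [CommRing A] [Algebra ℂ A]
variable {R R' : Type u} [Ring R] [Algebra ℂ R] [Ring R'] [Algebra ℂ R']

theorem exists_algEquiv_of_isCompleteFiltration
    (hR : IsCompleteFiltration (ncFiltrationSubmodule R))
    (hR' : IsCompleteFiltration (ncFiltrationSubmodule R'))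
    (i : NCAb R ≃ₐ[ℂ] A) (i' : NCAb R' ≃ₐ[ℂ] A) {φ : R →ₐ[ℂ] R'} {ψ : R' →ₐ[ℂ] R}
    (hφ : ∀ x, i' (NCAb.mk R' (φ x)) = i (NCAb.mk R x))
    (hψ : ∀ x, i (NCAb.mk R (ψ x)) = i' (NCAb.mk R' x)) :
    ∃ e : R ≃ₐ[ℂ] R', ∀ x, i' (NCAb.mk R' (e x)) = i (NCAb.mk R x) := by
  have hψφ : Function.Bijective (ψ.comp φ) := bijective_of_sub_mem_ncFiltration_one hR _ fun x =>
    NCAb.mk_eq_mk.1 (i.injective ((hψ _).trans (hφ x)))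
  have hφψ : Function.Bijective (φ.comp ψ) := bijective_of_sub_mem_ncFiltration_one hR' _ fun x =>
    NCAb.mk_eq_mk.1 (i'.injective ((hφ _).trans (hψ x)))
  exact ⟨AlgEquiv.ofBijective φ
    ⟨Function.Injective.of_comp hψφ.1, Function.Surjective.of_comp hφψ.2⟩, hφ⟩

theorem IsDSmooth.exists_algHom {d : ℕ} (hR : IsDSmooth d R) (hR' : IsNCNilpotent d R')
    (i : NCAb R ≃ₐ[ℂ] A) (i' : NCAb R' ≃ₐ[ℂ] A) :
    ∃ φ : R →ₐ[ℂ] R', ∀ x, i' (NCAb.mk R' (φ x)) = i (NCAb.mk R x) := by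
  obtain ⟨φ, hφ⟩ := hR.formallySmooth R' (NCAb R') hR' (isNCNilpotent_of_commRing _ d) (NCAb.mk R')
    NCAb.mk_surjective (hR'.isNilpotent_ker _ fun x hx => NCAb.mk_eq_zero.1 hx)
    ((i.trans i'.symm).toAlgHom.comp (NCAb.mk R))
  refine ⟨φ, fun x => ?_⟩
  have hx : NCAb.mk R' (φ x) = i'.symm (i (NCAb.mk R x)) := DFunLike.congr_fun hφ x
  rw [hx, AlgEquiv.apply_symm_apply]

theorem DSmoothThickening.exists_algEquiv {d : ℕ} (T : DSmoothThickening d A R)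
    (T' : DSmoothThickening d A R') :
    ∃ φ : R ≃ₐ[ℂ] R', ∀ x : R, T'.iso (NCAb.mk R' (φ x)) = T.iso (NCAb.mk R x) := by
  obtain ⟨φ, hφ⟩ := T.dSmooth.exists_algHom T'.dSmooth.ncNilpotent T.iso T'.iso
  obtain ⟨ψ, hψ⟩ := T'.dSmooth.exists_algHom T.dSmooth.ncNilpotent T'.iso T.iso
  exact exists_algEquiv_of_isCompleteFiltration T.dSmooth.ncNilpotent.isCompleteFiltration
    T'.dSmooth.ncNilpotent.isCompleteFiltration T.iso T'.iso hφ hψ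

theorem IsNCSmooth.exists_lift_succ (hR : IsNCSmooth R) (d : ℕ)
    (f : R →ₐ[ℂ] R' ⧸ ncFiltration R' (d + 1)) :
    ∃ g : R →ₐ[ℂ] R' ⧸ ncFiltration R' (d + 2),
      (Ideal.Quotient.factorₐ ℂ (ncFiltration_succ_le R' (d + 1))).comp g = f := by
  have hN : IsNCNilpotent (d + 1) (R' ⧸ ncFiltration R' (d + 1)) :=
    (isNCNilpotent_quotient d).mono (Nat.le_succ d)
  have hker : RingHom.ker (Ideal.Quotient.factorₐ ℂ (ncFiltration_succ_le R' (d + 1))) ≤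
      ncFiltration (R' ⧸ ncFiltration R' (d + 2)) 1 := fun x hx => by
    obtain ⟨x, rfl⟩ := Ideal.Quotient.mk_surjective x
    have hx' : x ∈ ncFiltration R' (d + 1) := Ideal.Quotient.eq_zero_iff_mem.1 hx
    exact map_mem_ncFiltration (Ideal.Quotient.mkₐ ℂ _)
      (ncFiltration_antitone (Nat.le_add_left 1 d) hx')
  obtain ⟨g, hg⟩ := (hR.quotient_dSmooth (d + 1)).formallySmooth _ _ (isNCNilpotent_quotient _) hN
    _ (Ideal.Quotient.factor_surjective (ncFiltration_succ_le R' (d + 1)))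
    ((isNCNilpotent_quotient (d + 1)).isNilpotent_ker _ hker)
    (Ideal.Quotient.liftₐ _ f fun x hx => hN.map_eq_zero f hx)
  refine ⟨g.comp (Ideal.Quotient.mkₐ ℂ _), ?_⟩
  rw [← AlgHom.comp_assoc, hg, Ideal.Quotient.liftₐ_comp]

theorem IsNCSmooth.exists_algHom (hR : IsNCSmooth R) (hR' : IsNCComplete R')
    (i : NCAb R ≃ₐ[ℂ] A) (i' : NCAb R' ≃ₐ[ℂ] A) :
    ∃ φ : R →ₐ[ℂ] R', ∀ x, i' (NCAb.mk R' (φ x)) = i (NCAb.mk R x) := by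
  choose next hnext using hR.exists_lift_succ (R' := R')
  let f₀ : R →ₐ[ℂ] R' ⧸ ncFiltration R' (0 + 1) := (i.trans i'.symm).toAlgHom.comp (NCAb.mk R)
  let f : ∀ d, R →ₐ[ℂ] R' ⧸ ncFiltration R' (d + 1) := fun d => Nat.rec f₀ next d
  let h : ∀ d, R →ₐ[ℂ] R' ⧸ ncFiltration R' d := fun d =>
    (Ideal.Quotient.factorₐ ℂ (ncFiltration_succ_le R' d)).comp (f d)
  have hf (d : ℕ) : h (d + 1) = f d := hnext d (f d)
  let F : R →ₐ[ℂ] NCCompletion R' := (AlgHom.pi h).codRestrict _ fun x d => by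
    change Ideal.Quotient.factorₐ ℂ _ (h (d + 1) x) = h d x
    rw [hf]
    rfl
  let e := AlgEquiv.ofBijective (toNCCompletion R') hR'
  refine ⟨e.symm.toAlgHom.comp F, fun x => ?_⟩
  have hF : (toNCCompletion R' (e.symm (F x))).1 1 = h 1 x :=
    congrFun (congrArg Subtype.val (e.apply_symm_apply (F x))) 1
  have hmk : NCAb.mk R' (e.symm (F x)) = i'.symm (i (NCAb.mk R x)) :=
    hF.trans (DFunLike.congr_fun (hf 0) x)
  change i' (NCAb.mk R' (e.symm (F x))) = _
  rw [hmk, AlgEquiv.apply_symm_apply]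

theorem NCSmoothThickening.exists_algEquiv (T : NCSmoothThickening A R)
    (T' : NCSmoothThickening A R') :
    ∃ φ : R ≃ₐ[ℂ] R', ∀ x : R, T'.iso (NCAb.mk R' (φ x)) = T.iso (NCAb.mk R x) := by
  obtain ⟨φ, hφ⟩ := T.ncSmooth.exists_algHom T'.ncSmooth.ncComplete T.iso T'.iso
  obtain ⟨ψ, hψ⟩ := T'.ncSmooth.exists_algHom T.ncSmooth.ncComplete T'.iso T.iso
  exact exists_algEquiv_of_isCompleteFiltration (isNCComplete_iff.1 T.ncSmooth.ncComplete)
    (isNCComplete_iff.1 T'.ncSmooth.ncComplete) T.iso T'.iso hφ hψ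

end Uniqueness

section Derivations

open KaehlerDifferential

theorem exists_derivation_lift {k A M N : Type*} [CommRing k] [CommRing A] [Algebra k A]
    [Algebra.FormallySmooth k A] [AddCommGroup M] [Module k M] [Module A M] [IsScalarTower k A M]
    [AddCommGroup N] [Module k N] [Module A N] [IsScalarTower k A N] (p : M →ₗ[A] N)
    (hp : Function.Surjective p) (D : Derivation k A N) :
    ∃ D' : Derivation k A M, ∀ a, p (D' a) = D a := by
  obtain ⟨l, hl⟩ := Module.projective_lifting_property p D.liftKaehlerDifferential hp
  refine ⟨l.compDer (KaehlerDifferential.D k A), fun a => ?_⟩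
  rw [← D.liftKaehlerDifferential_comp_D, ← hl]
  rfl

variable {R M : Type*} [Ring R] [Algebra ℂ R] [AddCommGroup M] [Module ℂ M] [Module (NCAb R) M]

theorem eq_zero_of_mem_ncFiltration_one {δ : R →ₗ[ℂ] M}
    (hδ : ∀ x y, δ (x * y) = NCAb.mk R x • δ y + NCAb.mk R y • δ x) {x : R}
    (hx : x ∈ ncFiltration R 1) : δ x = 0 := by
  let J : Ideal R :=
    { carrier := {x | NCAb.mk R x = 0 ∧ δ x = 0}
      add_mem' := fun hx hy => by simp [hx.1, hx.2, hy.1, hy.2]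
      zero_mem' := by simp
      smul_mem' := fun r x hx => by simp [hδ, hx.1, hx.2] }
  have : J.IsTwoSided := ⟨fun {x} y hx => ⟨by simp [hx.1], by simp [hδ, hx.1, hx.2]⟩⟩
  refine (ncFiltration_one_le (J := J) (fun x y => ⟨?_, ?_⟩) hx).2
  · rw [map_sub, map_mul, map_mul, mul_comm, sub_self]
  · rw [map_sub, hδ, hδ, add_comm, sub_self]

/-- A linear map on `R` satisfying the Leibniz rule, with values in a module over `R_ab`, as a
derivation of `R_ab`. -/
def ncAbDerivation (δ : R →ₗ[ℂ] M)
    (hδ : ∀ x y, δ (x * y) = NCAb.mk R x • δ y + NCAb.mk R y • δ x) :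
    Derivation ℂ (NCAb R) M :=
  Derivation.mk'
    (Submodule.liftQ (ncFiltrationSubmodule R 1) δ fun _ => eq_zero_of_mem_ncFiltration_one hδ)
    fun a b => by
      obtain ⟨x, rfl⟩ := NCAb.mk_surjective a
      obtain ⟨y, rfl⟩ := NCAb.mk_surjective b
      exact hδ x y

theorem ncAbDerivation_mk (δ : R →ₗ[ℂ] M)
    (hδ : ∀ x y, δ (x * y) = NCAb.mk R x • δ y + NCAb.mk R y • δ x) (x : R) :
    ncAbDerivation δ hδ (NCAb.mk R x) = δ x :=
  rfl

end Derivations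

section Splitting

open KaehlerDifferential

theorem exists_comp_comp_eq_self {A M N : Type*} [Ring A] [AddCommGroup M] [Module A M]
    [AddCommGroup N] [Module A N] [Module.Projective A N] (f : M →ₗ[A] N)
    [Module.Projective A (N ⧸ LinearMap.range f)] :
    ∃ σ : N →ₗ[A] M, f ∘ₗ σ ∘ₗ f = f := by
  obtain ⟨r, hr⟩ := Module.projective_lifting_property (LinearMap.range f).mkQ LinearMap.id
    (Submodule.mkQ_surjective _)
  let π : N →ₗ[A] LinearMap.range f :=
    (LinearMap.id - r ∘ₗ (LinearMap.range f).mkQ).codRestrict _ fun y => by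
      refine (Submodule.Quotient.mk_eq_zero _).1 ?_
      simpa [sub_eq_zero] using (LinearMap.congr_fun hr (Submodule.Quotient.mk y)).symm
  obtain ⟨σ, hσ⟩ := Module.projective_lifting_property f.rangeRestrict π f.surjective_rangeRestrict
  refine ⟨σ, LinearMap.ext fun x => ?_⟩
  have hx : f (σ (f x)) = π (f x) := congrArg Subtype.val (LinearMap.congr_fun hσ (f x))
  have hfx : (LinearMap.range f).mkQ (f x) = 0 := (Submodule.Quotient.mk_eq_zero _).2 ⟨x, rfl⟩
  rw [LinearMap.comp_apply, LinearMap.comp_apply, hx]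
  change f x - r ((LinearMap.range f).mkQ (f x)) = f x
  rw [hfx, map_zero, sub_zero]

variable (R : Type u) [Ring R] [Algebra ℂ R]

/-- The universal derivation of `R_ab` extended to the Hochschild chains `C₁(R, R_ab)`,
`a ⊗ x ↦ a dx`. -/
noncomputable def hochschildToKaehler : NCAb R ⊗[ℂ] R →ₗ[NCAb R] Ω[NCAb R⁄ℂ] :=
  LinearMap.liftBaseChange (NCAb R) ((D ℂ (NCAb R)).toLinearMap ∘ₗ (NCAb.mk R).toLinearMap)

theorem hochschildToKaehler_comp_boundaryTwo :
    hochschildToKaehler R ∘ₗ hochschildBoundaryTwo R = 0 := by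
  ext x y
  simp [hochschildToKaehler, hochschildBoundaryTwo_tmul]

/-- The class of `1 ⊗ x` in the cokernel of `C₂(R, R_ab) → C₁(R, R_ab)` is a derivation of `x`. -/
def hochschildCokerDerivation :
    Derivation ℂ (NCAb R) ((NCAb R ⊗[ℂ] R) ⧸ LinearMap.range (hochschildBoundaryTwo R)) :=
  ncAbDerivation (((LinearMap.range (hochschildBoundaryTwo R)).mkQ.restrictScalars ℂ) ∘ₗ
    TensorProduct.mk ℂ (NCAb R) R 1) fun x y => by
      have h : (LinearMap.range (hochschildBoundaryTwo R)).mkQ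
          (hochschildBoundaryTwo R (1 ⊗ₜ (x ⊗ₜ y))) = 0 :=
        (Submodule.Quotient.mk_eq_zero _).2 ⟨_, rfl⟩
      rw [hochschildBoundaryTwo_tmul, map_add, map_sub, sub_add_eq_add_sub, sub_eq_zero] at h
      simpa [← Submodule.Quotient.mk_smul, TensorProduct.smul_tmul'] using h.symm

theorem hochschildCokerDerivation_mk (x : R) :
    hochschildCokerDerivation R (NCAb.mk R x) =
      (LinearMap.range (hochschildBoundaryTwo R)).mkQ (1 ⊗ₜ x) :=
  rfl

/-- The cokernel of `C₂(R, R_ab) → C₁(R, R_ab)` is the module of Kähler differentials of `R_ab`. -/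
noncomputable def hochschildCokerEquivKaehler :
    ((NCAb R ⊗[ℂ] R) ⧸ LinearMap.range (hochschildBoundaryTwo R)) ≃ₗ[NCAb R] Ω[NCAb R⁄ℂ] :=
  LinearEquiv.ofLinearMap
    (Submodule.liftQ _ (hochschildToKaehler R) (LinearMap.range_le_ker_iff.2
      (hochschildToKaehler_comp_boundaryTwo R)))
    (hochschildCokerDerivation R).liftKaehlerDifferential
    (by
      refine Derivation.liftKaehlerDifferential_unique _ _ (Derivation.ext fun a => ?_)
      obtain ⟨x, rfl⟩ := NCAb.mk_surjective a
      simp [hochschildCokerDerivation_mk, hochschildToKaehler])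
    (by
      ext x
      simp [hochschildCokerDerivation_mk, hochschildToKaehler])

theorem exists_hochschildBoundaryTwo_splitting [Algebra.FormallySmooth ℂ (NCAb R)] :
    ∃ σ : NCAb R ⊗[ℂ] R →ₗ[NCAb R] NCAb R ⊗[ℂ] (R ⊗[ℂ] R),
      hochschildBoundaryTwo R ∘ₗ σ ∘ₗ hochschildBoundaryTwo R = hochschildBoundaryTwo R := by
  have := Module.Projective.of_equiv (hochschildCokerEquivKaehler R).symm
  exact exists_comp_comp_eq_self _

end Splitting

section Cochains

variable {R M N : Type u} [Ring R] [Algebra ℂ R] [AddCommGroup M] [Module ℂ M] [Module (NCAb R) M]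
  [IsScalarTower ℂ (NCAb R) M] [AddCommGroup N] [Module ℂ N] [Module (NCAb R) N]
  [IsScalarTower ℂ (NCAb R) N]

/-- The cocycle condition for a Hochschild 2-cochain with values in a module over `R_ab`. -/
def IsHochschildCocycle {R M : Type*} [Ring R] [Algebra ℂ R] [AddCommGroup M] [Module ℂ M]
    [Module (NCAb R) M] (c : R →ₗ[ℂ] R →ₗ[ℂ] M) : Prop :=
  ∀ x y z, NCAb.mk R x • c y z - c (x * y) z + c x (y * z) - NCAb.mk R z • c x y = 0

/-- The Hochschild coboundary of a 1-cochain with values in a module over `R_ab`. -/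
def hochschildCoboundary (τ : R →ₗ[ℂ] M) : R →ₗ[ℂ] R →ₗ[ℂ] M :=
  LinearMap.mk₂ ℂ (fun x y => NCAb.mk R x • τ y - τ (x * y) + NCAb.mk R y • τ x)
    (fun _ _ _ => by simp only [map_add, add_smul, add_mul, smul_add]; abel)
    (fun a _ _ => by simp [smul_add, smul_sub, smul_comm a])
    (fun _ _ _ => by simp only [map_add, add_smul, mul_add, smul_add]; abel)
    (fun a _ _ => by simp [smul_add, smul_sub, smul_comm a])

theorem hochschildCoboundary_apply (τ : R →ₗ[ℂ] M) (x y : R) :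
    hochschildCoboundary τ x y = NCAb.mk R x • τ y - τ (x * y) + NCAb.mk R y • τ x :=
  rfl

theorem hochschildPairing_tmul (c : R →ₗ[ℂ] R →ₗ[ℂ] M) (a : NCAb R) (x y : R) :
    hochschildPairing c (a ⊗ₜ (x ⊗ₜ y)) = a • c x y := by
  simp [hochschildPairing]

theorem hochschildPairing_compr₂ (φ : M →ₗ[NCAb R] N) (c : R →ₗ[ℂ] R →ₗ[ℂ] M) :
    hochschildPairing (c.compr₂ (φ.restrictScalars ℂ)) = φ ∘ₗ hochschildPairing c := by
  ext x y
  simp [hochschildPairing_tmul]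

theorem hochschildPairing_coboundary (τ : R →ₗ[ℂ] M) :
    hochschildPairing (hochschildCoboundary τ) =
      LinearMap.liftBaseChange (NCAb R) τ ∘ₗ hochschildBoundaryTwo R := by
  ext x y
  simp [hochschildPairing_tmul, hochschildBoundaryTwo_tmul, hochschildCoboundary_apply]

theorem IsHochschildCocycle.pairing_boundaryThree {c : R →ₗ[ℂ] R →ₗ[ℂ] M}
    (hc : IsHochschildCocycle c) : hochschildPairing c ∘ₗ hochschildBoundaryThree R = 0 := by
  ext x y z
  simpa [hochschildBoundaryThree_tmul, hochschildPairing_tmul] using hc x y z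

theorem exists_eq_hochschildCoboundary [Algebra.FormallySmooth ℂ (NCAb R)]
    {c : R →ₗ[ℂ] R →ₗ[ℂ] M}
    (hc : ∀ z, hochschildBoundaryTwo R z = 0 → hochschildPairing c z = 0) :
    ∃ τ, c = hochschildCoboundary τ := by
  obtain ⟨σ, hσ⟩ := exists_hochschildBoundaryTwo_splitting R
  have hcσ (z) : hochschildPairing c z = hochschildPairing c (σ (hochschildBoundaryTwo R z)) := by
    rw [← sub_eq_zero, ← map_sub]
    refine hc _ ?_
    rw [map_sub, sub_eq_zero]
    exact (LinearMap.congr_fun hσ z).symm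
  refine ⟨((hochschildPairing c ∘ₗ σ).restrictScalars ℂ) ∘ₗ TensorProduct.mk ℂ (NCAb R) R 1, ?_⟩
  have hτ (a : NCAb R) (x : R) : hochschildPairing c (σ (a ⊗ₜ x)) =
      a • hochschildPairing c (σ (1 ⊗ₜ x)) := by
    rw [← map_smul, ← map_smul, TensorProduct.smul_tmul', smul_eq_mul, mul_one]
  refine LinearMap.ext₂ fun x y => ?_
  have hxy := hcσ (1 ⊗ₜ (x ⊗ₜ y))
  rw [hochschildPairing_tmul, one_smul, hochschildBoundaryTwo_tmul, map_add, map_add, map_sub,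
    map_sub, hτ (1 * _), hτ (_ * 1), one_mul, mul_one] at hxy
  exact hxy

theorem HochschildH2.mk_eq_zero_of_boundaryThree (w : NCAb R ⊗[ℂ] (R ⊗[ℂ] (R ⊗[ℂ] R))) :
    HochschildH2.mk (hochschildBoundaryThree R w) (hochschildBoundaryTwo_boundaryThree R w) = 0 :=
  Subtype.ext ((Submodule.Quotient.mk_eq_zero _).2 ⟨w, rfl⟩)

theorem HochschildH2.mk_surjective (h : HochschildH2 R) :
    ∃ z hz, HochschildH2.mk z hz = h := by
  obtain ⟨_, z, hz, rfl⟩ := h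
  exact ⟨z, hz, rfl⟩

theorem IsHochschildCocycle.exists_linearMap_hochschildH2 {c : R →ₗ[ℂ] R →ₗ[ℂ] M}
    (hc : IsHochschildCocycle c) : ∃ φ : HochschildH2 R →ₗ[NCAb R] M,
      ∀ z hz, φ (HochschildH2.mk z hz) = hochschildPairing c z :=
  ⟨(LinearMap.range (hochschildBoundaryThree R)).liftQ (hochschildPairing c)
    (LinearMap.range_le_ker_iff.2 hc.pairing_boundaryThree) ∘ₗ Submodule.subtype _,
    fun _ _ => rfl⟩

variable (R) in
theorem exists_tautological_cocycle [Algebra.FormallySmooth ℂ (NCAb R)] :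
    ∃ c : R →ₗ[ℂ] R →ₗ[ℂ] HochschildH2 R, IsHochschildCocycle c ∧
      ∀ z hz, hochschildPairing c z = HochschildH2.mk z hz := by
  obtain ⟨σ, hσ⟩ := exists_hochschildBoundaryTwo_splitting R
  let r : NCAb R ⊗[ℂ] (R ⊗[ℂ] R) →ₗ[NCAb R] HochschildH2 R :=
    ((LinearMap.range (hochschildBoundaryThree R)).mkQ ∘ₗ
      (LinearMap.id - σ ∘ₗ hochschildBoundaryTwo R)).codRestrict _ fun z =>
      Submodule.mem_map_of_mem (by simpa [sub_eq_zero] using (LinearMap.congr_fun hσ z).symm)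
  have hr (z) (hz : hochschildBoundaryTwo R z = 0) : r z = HochschildH2.mk z hz :=
    Subtype.ext (by simp [r, HochschildH2.mk, hz])
  let c : R →ₗ[ℂ] R →ₗ[ℂ] HochschildH2 R :=
    TensorProduct.curry (r.restrictScalars ℂ ∘ₗ TensorProduct.mk ℂ (NCAb R) (R ⊗[ℂ] R) 1)
  have hcr : hochschildPairing c = r := by
    ext x y
    simp [c, hochschildPairing_tmul]
  refine ⟨c, fun x y z => ?_, fun z hz => by rw [hcr, hr]⟩
  have hxyz : hochschildPairing c (hochschildBoundaryThree R (1 ⊗ₜ (x ⊗ₜ (y ⊗ₜ z)))) = 0 := by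
    rw [hcr, hr _ (hochschildBoundaryTwo_boundaryThree R _),
      HochschildH2.mk_eq_zero_of_boundaryThree]
  simpa [hochschildBoundaryThree_tmul, hochschildPairing_tmul] using hxyz

end Cochains

section CocycleExtension

variable {R M : Type u} [Ring R] [Algebra ℂ R] [AddCommGroup M] [Module ℂ M] [Module (NCAb R) M]
  {c : R →ₗ[ℂ] R →ₗ[ℂ] M}

theorem IsHochschildCocycle.one_left (hc : IsHochschildCocycle c) (x : R) :
    c 1 x = NCAb.mk R x • c 1 1 := by
  simpa [sub_eq_zero] using hc 1 1 x

theorem IsHochschildCocycle.one_right (hc : IsHochschildCocycle c) (x : R) :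
    c x 1 = NCAb.mk R x • c 1 1 := by
  have h := hc x 1 1
  simp only [mul_one, map_one, one_smul, sub_add_cancel] at h
  exact (sub_eq_zero.1 h).symm

/-- The central extension `R ⊕ M` of `R` by `M` defined by a cocycle `c`, with multiplication
`(x, m) (y, n) = (x y, x n + y m + c(x, y))` and unit `(1, - c(1, 1))`. -/
def CocycleExtension (_ : IsHochschildCocycle c) : Type u := R × M

namespace CocycleExtension

variable (hc : IsHochschildCocycle c)

instance : AddCommGroup (CocycleExtension hc) := inferInstanceAs (AddCommGroup (R × M))

instance : Module ℂ (CocycleExtension hc) := inferInstanceAs (Module ℂ (R × M))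

/-- The projection of `R ⊕ M` to `R`. -/
def fst : CocycleExtension hc →ₗ[ℂ] R := LinearMap.fst ℂ R M

/-- The coordinate of `R ⊕ M` in `M`. -/
def snd : CocycleExtension hc →ₗ[ℂ] M := LinearMap.snd ℂ R M

/-- The linear section of the projection of `R ⊕ M` to `R`. -/
def inl : R →ₗ[ℂ] CocycleExtension hc := LinearMap.inl ℂ R M

/-- The inclusion of the kernel `M` in `R ⊕ M`. -/
def inr : M →ₗ[ℂ] CocycleExtension hc := LinearMap.inr ℂ R M

variable {hc}

@[ext]
theorem ext {e f : CocycleExtension hc} (h₁ : fst hc e = fst hc f) (h₂ : snd hc e = snd hc f) :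
    e = f :=
  Prod.ext h₁ h₂

@[simp] theorem fst_inl (x : R) : fst hc (inl hc x) = x := rfl
@[simp] theorem snd_inl (x : R) : snd hc (inl hc x) = 0 := rfl
@[simp] theorem fst_inr (m : M) : fst hc (inr hc m) = 0 := rfl
@[simp] theorem snd_inr (m : M) : snd hc (inr hc m) = m := rfl

instance : One (CocycleExtension hc) := ⟨((1 : R), -c 1 1)⟩

instance : Mul (CocycleExtension hc) :=
  ⟨fun e f => (fst hc e * fst hc f,
    NCAb.mk R (fst hc e) • snd hc f + NCAb.mk R (fst hc f) • snd hc e + c (fst hc e) (fst hc f))⟩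

@[simp] theorem fst_one : fst hc 1 = 1 := rfl
@[simp] theorem snd_one : snd hc 1 = -c 1 1 := rfl
@[simp] theorem fst_mul (e f : CocycleExtension hc) : fst hc (e * f) = fst hc e * fst hc f := rfl
@[simp] theorem snd_mul (e f : CocycleExtension hc) : snd hc (e * f) =
    NCAb.mk R (fst hc e) • snd hc f + NCAb.mk R (fst hc f) • snd hc e + c (fst hc e) (fst hc f) :=
  rfl

protected theorem mul_assoc (e f g : CocycleExtension hc) : e * f * g = e * (f * g) := by
  ext
  · simp [mul_assoc]
  · have h := hc (fst hc e) (fst hc f) (fst hc g)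
    rw [sub_eq_zero] at h
    simp only [snd_mul, fst_mul, map_mul, smul_add, mul_smul]
    rw [← h, smul_comm (NCAb.mk R (fst hc g)) (NCAb.mk R (fst hc e)),
      smul_comm (NCAb.mk R (fst hc g)) (NCAb.mk R (fst hc f))]
    abel

instance : Ring (CocycleExtension hc) :=
  { (inferInstance : AddCommGroup (CocycleExtension hc)) with
    left_distrib := fun e f g => by
      ext
      · simp [mul_add]
      · simp only [snd_mul, map_add, smul_add, add_smul]
        abel
    right_distrib := fun e f g => by
      ext
      · simp [add_mul]
      · simp only [snd_mul, map_add, smul_add, add_smul, LinearMap.add_apply]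
        abel
    zero_mul := fun e => by ext <;> simp
    mul_zero := fun e => by ext <;> simp
    mul_assoc := CocycleExtension.mul_assoc
    one_mul := fun e => by ext <;> simp [hc.one_left (fst hc e)]
    mul_one := fun e => by ext <;> simp [hc.one_right (fst hc e)] }

variable [IsScalarTower ℂ (NCAb R) M]

instance : Algebra ℂ (CocycleExtension hc) :=
  Algebra.ofModule (fun a e f => by ext <;> simp [smul_add, smul_comm _ a])
    (fun a e f => by ext <;> simp [smul_add, smul_comm _ a])

variable (hc)

/-- The projection of `R ⊕ M` to `R` as an algebra homomorphism. -/
def proj : CocycleExtension hc →ₐ[ℂ] R := AlgHom.ofLinearMap (fst hc) rfl fun _ _ => rfl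

@[simp] theorem proj_apply (e : CocycleExtension hc) : proj hc e = fst hc e := rfl

/-- The central extension of `R` by `M` defined by a Hochschild cocycle. -/
def centralExtension : CentralExtension R M (CocycleExtension hc) where
  proj := proj hc
  incl := inr hc
  proj_surjective x := ⟨inl hc x, rfl⟩
  incl_injective _ _ h := congrArg (snd hc) h
  exact e := ⟨fun h => ⟨snd hc e, CocycleExtension.ext (Eq.symm h) rfl⟩, by
    rintro ⟨m, rfl⟩
    rfl⟩
  mul_incl e m := by ext <;> simp
  incl_mul e m := by ext <;> simp

theorem inl_mul_inl (x y : R) :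
    inl hc x * inl hc y = inl hc (x * y) + (centralExtension hc).incl (c x y) := by
  ext <;> simp [centralExtension]

end CocycleExtension

theorem exists_isUniversal (R : Type u) [Ring R] [Algebra ℂ R]
    [Algebra.FormallySmooth ℂ (NCAb R)] :
    ∃ (E : Type u) (_ : Ring E) (_ : Algebra ℂ E)
      (X : CentralExtension R (HochschildH2 R) E), X.IsUniversal := by
  obtain ⟨c, hc, huniv⟩ := exists_tautological_cocycle R
  exact ⟨CocycleExtension hc, inferInstance, inferInstance, CocycleExtension.centralExtension hc,
    CocycleExtension.inl hc, c, fun _ => rfl, CocycleExtension.inl_mul_inl hc, huniv⟩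

end CocycleExtension

namespace CentralExtension

section Basic

variable {R M E : Type u} [Ring R] [Algebra ℂ R] [AddCommGroup M] [Module ℂ M] [Module (NCAb R) M]
  [Ring E] [Algebra ℂ E] (X : CentralExtension R M E)

theorem proj_incl (m : M) : X.proj (X.incl m) = 0 := (X.exact _).2 ⟨m, rfl⟩

theorem incl_mul_incl (m n : M) : X.incl m * X.incl n = 0 := by
  rw [X.mul_incl, X.proj_incl, map_zero, zero_smul, map_zero]

theorem isNilpotent_ker : IsNilpotent (RingHom.ker X.proj) := by
  refine ⟨2, le_bot_iff.1 ?_⟩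
  rw [Submodule.pow_succ, Submodule.pow_one, Ideal.mul_le]
  intro e he f hf
  obtain ⟨m, rfl⟩ := (X.exact e).1 he
  obtain ⟨n, rfl⟩ := (X.exact f).1 hf
  exact X.incl_mul_incl m n

theorem isNCNilpotent (X : CentralExtension R M E) {d : ℕ} (hR : IsNCNilpotent d R) :
    IsNCNilpotent (d + 1) E := by
  have hincl {u : E} (hu : u ∈ ncFiltration E (d + 1)) : ∃ m, X.incl m = u :=
    (X.exact u).1 (hR.map_eq_zero X.proj hu)
  refine isNCNilpotent_iff.2 fun x hx => ?_
  refine mem_of_mem_ncFiltration_succ (N := ⊥) (fun x u hu => ?_) (fun v hv u hu => ?_) hx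
  · obtain ⟨m, rfl⟩ := hincl hu
    rw [Submodule.mem_bot, X.mul_incl, X.incl_mul, sub_self]
  · obtain ⟨m, rfl⟩ := hincl hu
    rw [Submodule.mem_bot, X.mul_incl, NCAb.mk_eq_zero.2 (map_mem_ncFiltration X.proj hv),
      zero_smul, map_zero]

theorem exists_section : ∃ s : R →ₗ[ℂ] E, ∀ x, X.proj (s x) = x := by
  obtain ⟨s, hs⟩ := X.proj.toLinearMap.exists_rightInverse_of_surjective
    (LinearMap.range_eq_top.2 X.proj_surjective)
  exact ⟨s, LinearMap.congr_fun hs⟩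

theorem exists_eq_incl_comp {V : Type*} [AddCommGroup V] [Module ℂ V] (f : V →ₗ[ℂ] E)
    (hf : ∀ v, X.proj (f v) = 0) : ∃ g : V →ₗ[ℂ] M, ∀ v, f v = X.incl (g v) := by
  obtain ⟨l, hl⟩ := X.incl.exists_leftInverse_of_injective (LinearMap.ker_eq_bot.2 X.incl_injective)
  refine ⟨l ∘ₗ f, fun v => ?_⟩
  obtain ⟨m, hm⟩ := (X.exact _).1 (hf v)
  rw [LinearMap.comp_apply, ← hm]
  exact congrArg X.incl (LinearMap.congr_fun hl m).symm

theorem exists_coordinate {s : R →ₗ[ℂ] E} (hs : ∀ x, X.proj (s x) = x) :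
    ∃ η : E →ₗ[ℂ] M, ∀ e, e = s (X.proj e) + X.incl (η e) := by
  obtain ⟨η, hη⟩ := X.exists_eq_incl_comp (LinearMap.id - s ∘ₗ X.proj.toLinearMap) fun e => by
    simp [hs]
  exact ⟨η, fun e => by simp [← hη]⟩

theorem exists_cocycle {s : R →ₗ[ℂ] E} (hs : ∀ x, X.proj (s x) = x) :
    ∃ c : R →ₗ[ℂ] R →ₗ[ℂ] M, ∀ x y, s x * s y = s (x * y) + X.incl (c x y) := by
  obtain ⟨c, hc⟩ := X.exists_eq_incl_comp
    (LinearMap.mul' ℂ E ∘ₗ TensorProduct.map s s - s ∘ₗ LinearMap.mul' ℂ R) fun v => by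
      induction v using TensorProduct.induction_on with
      | zero => simp
      | tmul x y => simp [hs]
      | add v w hv hw => rw [map_add, map_add, hv, hw, add_zero]
  exact ⟨TensorProduct.curry c, fun x y => by simp [← hc]⟩

variable {X} {s : R →ₗ[ℂ] E} {c : R →ₗ[ℂ] R →ₗ[ℂ] M}

theorem isHochschildCocycle (hs : ∀ x, X.proj (s x) = x)
    (hsc : ∀ x y, s x * s y = s (x * y) + X.incl (c x y)) : IsHochschildCocycle c := by
  refine fun x y z => X.incl_injective ?_
  have h := mul_assoc (s x) (s y) (s z)
  rw [hsc, hsc, add_mul, mul_add, X.incl_mul, X.mul_incl, hs, hs, hsc, hsc, mul_assoc, add_assoc,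
    add_assoc, add_right_inj, ← sub_eq_iff_eq_add'] at h
  rw [map_sub, map_add, map_sub, map_zero, sub_eq_zero, ← h]
  abel

theorem coordinate_mul (hs : ∀ x, X.proj (s x) = x)
    (hsc : ∀ x y, s x * s y = s (x * y) + X.incl (c x y)) {η : E →ₗ[ℂ] M}
    (hη : ∀ e, e = s (X.proj e) + X.incl (η e)) (e f : E) :
    η (e * f) = c (X.proj e) (X.proj f) + NCAb.mk R (X.proj e) • η f
      + NCAb.mk R (X.proj f) • η e := by
  apply X.incl_injective
  have hef : e * f = (s (X.proj e) + X.incl (η e)) * (s (X.proj f) + X.incl (η f)) := by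
    rw [← hη, ← hη]
  have hη' := hη (e * f)
  rw [map_mul X.proj, ← sub_eq_iff_eq_add'] at hη'
  rw [← hη', hef, add_mul, mul_add, mul_add, hsc, X.mul_incl, X.incl_mul, X.incl_mul_incl, hs, hs,
    map_add, map_add]
  abel

variable [IsScalarTower ℂ (NCAb R) M]

theorem eq_hochschildCoboundary_of_split (hs : ∀ x, X.proj (s x) = x)
    (hsc : ∀ x y, s x * s y = s (x * y) + X.incl (c x y)) {g : R →ₐ[ℂ] E}
    (hg : X.proj.comp g = AlgHom.id ℂ R) : ∃ τ, c = hochschildCoboundary τ := by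
  obtain ⟨η, hη⟩ := X.exists_coordinate hs
  have hproj (x : R) : X.proj (g x) = x := DFunLike.congr_fun hg x
  refine ⟨-(η ∘ₗ g.toLinearMap), LinearMap.ext₂ fun x y => ?_⟩
  have hxy : η (g (x * y)) = c x y + NCAb.mk R x • η (g y) + NCAb.mk R y • η (g x) := by
    rw [map_mul, coordinate_mul hs hsc hη, hproj, hproj]
  simp only [hochschildCoboundary_apply, LinearMap.neg_apply, LinearMap.comp_apply,
    AlgHom.toLinearMap_apply, hxy, smul_neg]
  abel

end Basic

section Quotient

variable {R M E : Type u} [Ring R] [Algebra ℂ R] [AddCommGroup M] [Module ℂ M] [Module (NCAb R) M]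
  [Ring E] [Algebra ℂ E] (X : CentralExtension R M E)

/-- The submodule of the kernel of a central extension of `R` cut out by an ideal. -/
def comapIncl (I : Ideal E) : Submodule (NCAb R) M where
  carrier := {m | X.incl m ∈ I}
  add_mem' hm hn := by simpa only [Set.mem_ofPred_eq, map_add] using add_mem hm hn
  zero_mem' := by simp
  smul_mem' a m hm := by
    obtain ⟨x, rfl⟩ := NCAb.mk_surjective a
    obtain ⟨e, rfl⟩ := X.proj_surjective x
    rw [Set.mem_ofPred_eq, ← X.mul_incl]
    exact I.mul_mem_left e hm

theorem mem_comapIncl {I : Ideal E} {m : M} : m ∈ X.comapIncl I ↔ X.incl m ∈ I := Iff.rfl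

variable [IsScalarTower ℂ (NCAb R) M]

/-- The central extension of `R` obtained by dividing out a two-sided ideal contained in the
kernel. -/
def quotient (I : Ideal E) [I.IsTwoSided] (hI : I ≤ RingHom.ker X.proj) :
    CentralExtension R (M ⧸ X.comapIncl I) (E ⧸ I) where
  proj := Ideal.Quotient.liftₐ I X.proj hI
  incl := ((X.comapIncl I).restrictScalars ℂ).liftQ
      ((Ideal.Quotient.mkₐ ℂ I).toLinearMap ∘ₗ X.incl)
      (fun _ hm => Ideal.Quotient.eq_zero_iff_mem.2 hm) ∘ₗ
    (Submodule.Quotient.restrictScalarsEquiv ℂ (X.comapIncl I)).symm.toLinearMap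
  proj_surjective := Ideal.Quotient.lift_surjective_of_surjective I hI X.proj_surjective
  incl_injective := by
    rw [injective_iff_map_eq_zero]
    intro m hm
    obtain ⟨m, rfl⟩ := Submodule.mkQ_surjective _ m
    exact (Submodule.Quotient.mk_eq_zero _).2 (Ideal.Quotient.eq_zero_iff_mem.1 hm)
  exact e := by
    obtain ⟨e, rfl⟩ := Ideal.Quotient.mk_surjective e
    refine (X.exact e).trans ⟨?_, ?_⟩
    · rintro ⟨m, rfl⟩
      exact ⟨Submodule.Quotient.mk m, rfl⟩
    · rintro ⟨m, hm⟩
      obtain ⟨m, rfl⟩ := Submodule.mkQ_surjective _ m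
      refine (X.exact e).1 ?_
      have h : X.incl m - e ∈ RingHom.ker X.proj := hI (Ideal.Quotient.eq.1 hm)
      rwa [RingHom.mem_ker, map_sub, X.proj_incl, zero_sub, neg_eq_zero] at h
  mul_incl e m := by
    obtain ⟨e, rfl⟩ := Ideal.Quotient.mk_surjective e
    obtain ⟨m, rfl⟩ := Submodule.mkQ_surjective _ m
    exact congrArg (Ideal.Quotient.mk I) (X.mul_incl e m)
  incl_mul e m := by
    obtain ⟨e, rfl⟩ := Ideal.Quotient.mk_surjective e
    obtain ⟨m, rfl⟩ := Submodule.mkQ_surjective _ m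
    exact congrArg (Ideal.Quotient.mk I) (X.incl_mul e m)

theorem hochschildPairing_mem_comapIncl {d : ℕ} (hR : IsDSmooth d R) {s : R →ₗ[ℂ] E}
    {c : R →ₗ[ℂ] R →ₗ[ℂ] M} (hs : ∀ x, X.proj (s x) = x)
    (hsc : ∀ x y, s x * s y = s (x * y) + X.incl (c x y)) {z : NCAb R ⊗[ℂ] (R ⊗[ℂ] R)}
    (hz : hochschildBoundaryTwo R z = 0) :
    hochschildPairing c z ∈ X.comapIncl (ncFiltration E (d + 1)) := by
  let I := ncFiltration E (d + 1)
  let Y := X.quotient I fun x hx => hR.ncNilpotent.map_eq_zero X.proj hx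
  obtain ⟨g, hg⟩ := hR.formallySmooth _ _ (isNCNilpotent_quotient d) hR.ncNilpotent Y.proj
    Y.proj_surjective Y.isNilpotent_ker (AlgHom.id ℂ R)
  obtain ⟨τ, hτ⟩ := eq_hochschildCoboundary_of_split (X := Y)
    (s := (Ideal.Quotient.mkₐ ℂ I).toLinearMap ∘ₗ s)
    (c := c.compr₂ ((X.comapIncl I).mkQ.restrictScalars ℂ)) hs
    (fun x y => congrArg (Ideal.Quotient.mkₐ ℂ I) (hsc x y)) hg
  have hpair := hochschildPairing_compr₂ (X.comapIncl I).mkQ c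
  rw [hτ, hochschildPairing_coboundary] at hpair
  have h := LinearMap.congr_fun hpair z
  rw [LinearMap.comp_apply, hz, map_zero] at h
  exact (Submodule.Quotient.mk_eq_zero _).1 h.symm

end Quotient

section Morphisms

variable {R M N E P : Type u} [Ring R] [Algebra ℂ R] [AddCommGroup M] [Module ℂ M]
  [Module (NCAb R) M] [AddCommGroup N] [Module ℂ N] [Module (NCAb R) N]
  [Ring E] [Algebra ℂ E] [Ring P] [Algebra ℂ P]
  {X : CentralExtension R M E} {Y : CentralExtension R N P}

theorem eq_one_of_isIdempotentElem {e : E} (he : IsIdempotentElem e) (hproj : X.proj e = 1) :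
    e = 1 := by
  obtain ⟨m, hm⟩ := (X.exact (e - 1)).1 (by rw [map_sub, map_one, hproj, sub_self])
  have hsq : (e - 1) * (e - 1) = 0 := by rw [← hm, X.incl_mul_incl]
  rw [sub_mul, mul_sub, he.eq, mul_one, one_mul, sub_self, zero_sub, neg_eq_zero] at hsq
  exact sub_eq_zero.1 hsq

theorem exists_algHom_of_cocycle_eq [IsScalarTower ℂ (NCAb R) M] [IsScalarTower ℂ (NCAb R) N]
    {s : R →ₗ[ℂ] E} {c : R →ₗ[ℂ] R →ₗ[ℂ] M} (hs : ∀ x, X.proj (s x) = x)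
    (hsc : ∀ x y, s x * s y = s (x * y) + X.incl (c x y)) {t : R →ₗ[ℂ] P}
    (φ : M →ₗ[NCAb R] N) (ht : ∀ x, Y.proj (t x) = x)
    (htc : ∀ x y, t x * t y = t (x * y) + Y.incl (φ (c x y))) :
    ∃ G : E →ₐ[ℂ] P, Y.proj.comp G = X.proj := by
  obtain ⟨η, hη⟩ := X.exists_coordinate hs
  let G : E →ₗ[ℂ] P := t ∘ₗ X.proj.toLinearMap + Y.incl ∘ₗ φ.restrictScalars ℂ ∘ₗ η
  have hG (e : E) : G e = t (X.proj e) + Y.incl (φ (η e)) := rfl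
  have hproj (e : E) : Y.proj (G e) = X.proj e := by
    rw [hG, map_add, ht, Y.proj_incl, add_zero]
  have hmul (e f : E) : G (e * f) = G e * G f := by
    simp only [hG, add_mul, mul_add, htc, Y.mul_incl, Y.incl_mul, ht, Y.proj_incl, map_mul,
      coordinate_mul hs hsc hη, map_add, map_smul, add_zero]
    abel
  have hone : G 1 = 1 := eq_one_of_isIdempotentElem (X := Y) (by
    rw [IsIdempotentElem, ← hmul, one_mul]) (by rw [hproj, map_one])
  exact ⟨AlgHom.ofLinearMap G hone hmul, AlgHom.ext hproj⟩

theorem mul_sub_incl_hochschildCoboundary [IsScalarTower ℂ (NCAb R) N] {t : R →ₗ[ℂ] P}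
    {b : R →ₗ[ℂ] R →ₗ[ℂ] N} (ht : ∀ x, Y.proj (t x) = x)
    (htb : ∀ x y, t x * t y = t (x * y) + Y.incl (b x y)) (τ : R →ₗ[ℂ] N) (x y : R) :
    (t - Y.incl ∘ₗ τ) x * (t - Y.incl ∘ₗ τ) y =
      (t - Y.incl ∘ₗ τ) (x * y) + Y.incl ((b - hochschildCoboundary τ) x y) := by
  simp only [LinearMap.sub_apply, LinearMap.comp_apply, sub_mul, mul_sub, htb, Y.mul_incl,
    Y.incl_mul, ht, Y.proj_incl, hochschildCoboundary_apply, map_sub, map_add, sub_zero]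
  abel

end Morphisms

section Universal

variable {R E : Type u} [Ring R] [Algebra ℂ R] [Ring E] [Algebra ℂ E]
  {X : CentralExtension R (HochschildH2 R) E}

theorem IsUniversal.exists_algHom [Algebra.FormallySmooth ℂ (NCAb R)] (hX : X.IsUniversal)
    {N P : Type u} [AddCommGroup N] [Module ℂ N] [Module (NCAb R) N] [IsScalarTower ℂ (NCAb R) N]
    [Ring P] [Algebra ℂ P] (Y : CentralExtension R N P) :
    ∃ G : E →ₐ[ℂ] P, Y.proj.comp G = X.proj := by
  obtain ⟨s, c, hs, hsc, huniv⟩ := hX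
  obtain ⟨t, ht⟩ := Y.exists_section
  obtain ⟨b, htb⟩ := Y.exists_cocycle ht
  obtain ⟨φ, hφ⟩ := (isHochschildCocycle ht htb).exists_linearMap_hochschildH2
  obtain ⟨τ, hτ⟩ := exists_eq_hochschildCoboundary (c := b - c.compr₂ (φ.restrictScalars ℂ))
    fun z hz => by
      have hsub : hochschildPairing (b - c.compr₂ (φ.restrictScalars ℂ)) =
          hochschildPairing b - φ ∘ₗ hochschildPairing c := by
        ext x y
        simp [hochschildPairing_tmul]
      rw [hsub, LinearMap.sub_apply, LinearMap.comp_apply, huniv z hz, hφ, sub_self]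
  refine exists_algHom_of_cocycle_eq hs hsc φ (t := t - Y.incl ∘ₗ τ)
    (fun x => by simp [ht, Y.proj_incl]) fun x y => ?_
  rw [mul_sub_incl_hochschildCoboundary ht htb, ← hτ, sub_sub_cancel]
  rfl

theorem IsUniversal.incl_mem {d : ℕ} (hR : IsDSmooth d R) (hX : X.IsUniversal)
    (h : HochschildH2 R) : X.incl h ∈ ncFiltration E (d + 1) := by
  obtain ⟨s, c, hs, hsc, huniv⟩ := hX
  obtain ⟨z, hz, rfl⟩ := h.mk_surjective
  rw [← huniv z hz, ← X.mem_comapIncl]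
  exact X.hochschildPairing_mem_comapIncl hR hs hsc hz

theorem IsUniversal.ker_proj_le {d : ℕ} (hR : IsDSmooth d R) (hX : X.IsUniversal) :
    RingHom.ker X.proj ≤ ncFiltration E (d + 1) := fun e he => by
  obtain ⟨h, rfl⟩ := (X.exact e).1 he
  exact hX.incl_mem hR h

theorem IsUniversal.map_proj_bijective {d : ℕ} (hR : IsDSmooth d R) (hX : X.IsUniversal) :
    Function.Bijective (NCAb.map X.proj) :=
  NCAb.map_bijective X.proj X.proj_surjective
    ((hX.ker_proj_le hR).trans (ncFiltration_antitone (Nat.le_add_left 1 d)))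

theorem IsUniversal.exists_ncAb_equiv {d : ℕ} (hR : IsDSmooth d R) (hX : X.IsUniversal) :
    ∃ ψ : NCAb E ≃ₐ[ℂ] NCAb R, ∀ x : E, ψ (NCAb.mk E x) = NCAb.mk R (X.proj x) :=
  ⟨AlgEquiv.ofBijective _ (hX.map_proj_bijective hR), NCAb.map_mk X.proj⟩

end Universal

end CentralExtension

section TopPiece

variable {Λ : Type u} [Ring Λ] [Algebra ℂ Λ] {A : Type u} [CommRing A] [Algebra ℂ A] {d : ℕ}

theorem IsNCNilpotent.mul_eq_zero_of_mem (hΛ : IsNCNilpotent (d + 1) Λ) {v m : Λ}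
    (hv : v ∈ ncFiltration Λ 1) (hm : m ∈ ncFiltration Λ (d + 1)) : v * m = 0 :=
  hΛ.eq_zero (Nat.add_comm 1 (d + 1)).ge (mul_mem_ncFiltration hv hm)

theorem IsNCNilpotent.mul_comm_of_mem (hΛ : IsNCNilpotent (d + 1) Λ) {m : Λ}
    (hm : m ∈ ncFiltration Λ (d + 1)) (x : Λ) : m * x = x * m :=
  (sub_eq_zero.1 (hΛ.eq_zero le_rfl (commutator_mem_ncFiltration_succ x hm))).symm

/-- The last step `F^{d+1}Λ` of the NC-filtration of an algebra `Λ` with `F^{d+2}Λ = 0`, as a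
module over `Λ_ab`. -/
abbrev IsNCNilpotent.topModule (hΛ : IsNCNilpotent (d + 1) Λ) :
    Module (NCAb Λ) (ncFiltration Λ (d + 1)) :=
  Module.IsTorsionBySet.module (I := ncFiltration Λ 1) fun m v =>
    Subtype.ext (hΛ.mul_eq_zero_of_mem v.2 m.2)

/-- The last step `F^{d+1}Λ` of the NC-filtration, regarded as a module over `A` by means of
`ρ : A → Λ_ab`. -/
def TopPiece (_ : IsNCNilpotent (d + 1) Λ) (_ : A →ₐ[ℂ] NCAb Λ) : Type u :=
  ncFiltrationSubmodule Λ (d + 1)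

namespace TopPiece

section Instances

variable (hΛ : IsNCNilpotent (d + 1) Λ) (ρ : A →ₐ[ℂ] NCAb Λ)

instance : AddCommGroup (TopPiece hΛ ρ) :=
  inferInstanceAs (AddCommGroup (ncFiltrationSubmodule Λ (d + 1)))

instance : Module ℂ (TopPiece hΛ ρ) :=
  inferInstanceAs (Module ℂ (ncFiltrationSubmodule Λ (d + 1)))

instance : Module A (TopPiece hΛ ρ) :=
  letI := hΛ.topModule
  (Module.compHom (ncFiltration Λ (d + 1)) ρ.toRingHom : Module A (ncFiltration Λ (d + 1)))

/-- The inclusion of `F^{d+1}Λ` in `Λ`. -/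
def incl : TopPiece hΛ ρ →ₗ[ℂ] Λ := (ncFiltrationSubmodule Λ (d + 1)).subtype

theorem incl_injective : Function.Injective (incl hΛ ρ) := Subtype.val_injective

end Instances

variable {hΛ : IsNCNilpotent (d + 1) Λ} {ρ : A →ₐ[ℂ] NCAb Λ}

theorem exists_incl_eq {x : Λ} (hx : x ∈ ncFiltration Λ (d + 1)) :
    ∃ m : TopPiece hΛ ρ, incl hΛ ρ m = x :=
  ⟨⟨x, hx⟩, rfl⟩

/-- A linear map to `Λ` with values in `F^{d+1}Λ`, as a linear map to `F^{d+1}Λ`. -/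
def codRestrict {V : Type*} [AddCommGroup V] [Module ℂ V] (f : V →ₗ[ℂ] Λ)
    (hf : ∀ v, f v ∈ ncFiltration Λ (d + 1)) : V →ₗ[ℂ] TopPiece hΛ ρ :=
  LinearMap.codRestrict (ncFiltrationSubmodule Λ (d + 1)) f hf

theorem incl_codRestrict {V : Type*} [AddCommGroup V] [Module ℂ V] {f : V →ₗ[ℂ] Λ}
    (hf : ∀ v, f v ∈ ncFiltration Λ (d + 1)) (v : V) :
    incl hΛ ρ (codRestrict f hf v) = f v :=
  rfl

theorem incl_mem (m : TopPiece hΛ ρ) : incl hΛ ρ m ∈ ncFiltration Λ (d + 1) := m.2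

theorem incl_smul {a : A} {v : Λ} (h : ρ a = NCAb.mk Λ v) (m : TopPiece hΛ ρ) :
    incl hΛ ρ (a • m) = v * incl hΛ ρ m := by
  let _ := hΛ.topModule
  have h_smul (m : ncFiltration Λ (d + 1)) : ((ρ a • m : ncFiltration Λ (d + 1)) : Λ) = v * m := by
    rw [h]
    rfl
  exact h_smul m

theorem incl_mul (m : TopPiece hΛ ρ) (v : Λ) : incl hΛ ρ m * v = v * incl hΛ ρ m :=
  hΛ.mul_comm_of_mem (incl_mem m) v

theorem incl_mul_incl (m n : TopPiece hΛ ρ) : incl hΛ ρ m * incl hΛ ρ n = 0 :=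
  hΛ.mul_eq_zero_of_mem (ncFiltration_antitone (Nat.le_add_left 1 d) (incl_mem m)) (incl_mem n)

instance : IsScalarTower ℂ A (TopPiece hΛ ρ) where
  smul_assoc c a m := by
    obtain ⟨v, hv⟩ := NCAb.mk_surjective (ρ a)
    apply incl_injective hΛ ρ
    rw [incl_smul (v := c • v) (by rw [map_smul, map_smul, hv]), map_smul, incl_smul hv.symm,
      smul_mul_assoc]

variable {Λ' : Type u} [Ring Λ'] [Algebra ℂ Λ']

/-- The linear map of last steps of the NC-filtrations induced by a homomorphism. -/
def map (p : Λ' →ₐ[ℂ] Λ) {hΛ' : IsNCNilpotent (d + 1) Λ'} {ρ' : A →ₐ[ℂ] NCAb Λ'}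
    (hp : (NCAb.map p).comp ρ' = ρ) : TopPiece hΛ' ρ' →ₗ[A] TopPiece hΛ ρ where
  __ := codRestrict (hΛ := hΛ) (ρ := ρ) (p.toLinearMap ∘ₗ incl hΛ' ρ') fun m =>
    map_mem_ncFiltration p (incl_mem m)
  map_smul' a m := by
    obtain ⟨v, hv⟩ := NCAb.mk_surjective (ρ' a)
    have hpv : ρ a = NCAb.mk Λ (p v) := by rw [← hp, AlgHom.comp_apply, ← hv, NCAb.map_mk]
    apply incl_injective hΛ ρ
    rw [RingHom.id_apply, incl_smul hpv]
    change p (incl hΛ' ρ' (a • m)) = p v * p (incl hΛ' ρ' m)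
    rw [incl_smul hv.symm, map_mul]

variable {p : Λ' →ₐ[ℂ] Λ} {hΛ' : IsNCNilpotent (d + 1) Λ'} {ρ' : A →ₐ[ℂ] NCAb Λ'}

theorem incl_map (hp : (NCAb.map p).comp ρ' = ρ) (m : TopPiece hΛ' ρ') :
    incl hΛ ρ (map p hp m) = p (incl hΛ' ρ' m) :=
  rfl

theorem map_surjective (hp : (NCAb.map p).comp ρ' = ρ) (hsurj : Function.Surjective p) :
    Function.Surjective (map (hΛ := hΛ) (hΛ' := hΛ') p hp) := fun y => by
  obtain ⟨x, hx, hxy⟩ := exists_mem_ncFiltration_of_surjective p hsurj (incl_mem y)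
  obtain ⟨m, rfl⟩ := exists_incl_eq (hΛ := hΛ') (ρ := ρ') hx
  exact ⟨m, incl_injective hΛ ρ hxy⟩

variable {E : Type u} [Ring E] [Algebra ℂ E]

/-- The difference of two homomorphisms to `Λ` that agree modulo `F^{d+1}Λ`, as a derivation. -/
def derivationOfSub (f g : E →ₐ[ℂ] Λ) (h : ∀ e, f e - g e ∈ ncFiltration Λ (d + 1)) :
    Derivation ℂ (NCAb E) (TopPiece hΛ (NCAb.map g)) :=
  ncAbDerivation (codRestrict (f.toLinearMap - g.toLinearMap) (by simpa using h)) fun x y => by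
    have hxy : (f x - g x) * (f y - g y) = 0 :=
      hΛ.mul_eq_zero_of_mem (ncFiltration_antitone (Nat.le_add_left 1 d) (h x)) (h y)
    apply incl_injective
    rw [map_add, incl_smul (NCAb.map_mk g x), incl_smul (NCAb.map_mk g y), ← incl_mul _ (g y)]
    simp only [incl_codRestrict, LinearMap.sub_apply, AlgHom.toLinearMap_apply]
    rw [map_mul, map_mul, ← sub_eq_zero, ← hxy]
    noncomm_ring

theorem incl_derivationOfSub {f g : E →ₐ[ℂ] Λ} (h : ∀ e, f e - g e ∈ ncFiltration Λ (d + 1))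
    (e : E) : incl hΛ (NCAb.map g) (derivationOfSub f g h (NCAb.mk E e)) = f e - g e := by
  rw [derivationOfSub, ncAbDerivation_mk, incl_codRestrict]
  rfl

/-- The sum of a homomorphism to `Λ` and a derivation with values in `F^{d+1}Λ`. -/
def algHomAdd (g : E →ₐ[ℂ] Λ) (D : Derivation ℂ (NCAb E) (TopPiece hΛ (NCAb.map g))) :
    E →ₐ[ℂ] Λ :=
  AlgHom.ofLinearMap
    (g.toLinearMap + incl hΛ (NCAb.map g) ∘ₗ D.toLinearMap ∘ₗ (NCAb.mk E).toLinearMap)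
    (by simp) fun x y => by
      simp only [LinearMap.add_apply, LinearMap.comp_apply, AlgHom.toLinearMap_apply,
        Derivation.coeFn_coe, map_mul, Derivation.leibniz, map_add,
        incl_smul (NCAb.map_mk g _), add_mul, mul_add, incl_mul _ (g _), incl_mul_incl]
      abel

theorem algHomAdd_apply (g : E →ₐ[ℂ] Λ) (D : Derivation ℂ (NCAb E) (TopPiece hΛ (NCAb.map g)))
    (e : E) : algHomAdd g D e = g e + incl hΛ (NCAb.map g) (D (NCAb.mk E e)) :=
  rfl

variable {R : Type u} [Ring R] [Algebra ℂ R]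

/-- The fibre product of `Λ` and `R` over `Λ/F^{d+1}Λ`. -/
abbrev pullbackAlgebra (g : R →ₐ[ℂ] Λ ⧸ ncFiltration Λ (d + 1)) : Subalgebra ℂ (Λ × R) :=
  AlgHom.equalizer ((Ideal.Quotient.mkₐ ℂ (ncFiltration Λ (d + 1))).comp (AlgHom.fst ℂ Λ R))
    (g.comp (AlgHom.snd ℂ Λ R))

/-- The homomorphism of commutativizations induced by a homomorphism to `Λ/F^{d+1}Λ`. -/
def ncAbLift (g : R →ₐ[ℂ] Λ ⧸ ncFiltration Λ (d + 1)) : NCAb R →ₐ[ℂ] NCAb Λ :=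
  NCAb.lift (B := NCAb Λ)
    ((Ideal.Quotient.factorₐ ℂ (ncFiltration_antitone (Nat.le_add_left 1 d))).comp g)

theorem ncAbLift_mk {g : R →ₐ[ℂ] Λ ⧸ ncFiltration Λ (d + 1)} {x : R} {v : Λ}
    (h : Ideal.Quotient.mkₐ ℂ (ncFiltration Λ (d + 1)) v = g x) :
    ncAbLift g (NCAb.mk R x) = NCAb.mk Λ v := by
  change Ideal.Quotient.factorₐ ℂ (ncFiltration_antitone (Nat.le_add_left 1 d)) (g x) = _
  rw [← h]
  rfl

/-- The central extension of `R` by `F^{d+1}Λ` pulled back from `Λ → Λ/F^{d+1}Λ` along a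
homomorphism `g`. -/
def pullback (hΛ : IsNCNilpotent (d + 1) Λ) (g : R →ₐ[ℂ] Λ ⧸ ncFiltration Λ (d + 1)) :
    CentralExtension R (TopPiece hΛ (ncAbLift g)) (pullbackAlgebra g) where
  proj := (AlgHom.snd ℂ Λ R).comp (pullbackAlgebra g).val
  incl := LinearMap.codRestrict (pullbackAlgebra g).toSubmodule
    (LinearMap.prod (incl hΛ (ncAbLift g)) 0) fun m =>
      (Ideal.Quotient.eq_zero_iff_mem.2 (incl_mem m)).trans (map_zero g).symm
  proj_surjective x := by
    obtain ⟨v, hv⟩ := Ideal.Quotient.mkₐ_surjective ℂ _ (g x)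
    exact ⟨⟨(v, x), hv⟩, rfl⟩
  incl_injective m n h := incl_injective hΛ _ (congrArg (fun e => e.1.1) h)
  exact := by
    rintro ⟨⟨v, x⟩, hvx⟩
    constructor
    · rintro rfl
      obtain ⟨m, rfl⟩ := exists_incl_eq (hΛ := hΛ) (ρ := ncAbLift g) (d := d) (x := v)
        (Ideal.Quotient.eq_zero_iff_mem.1 (hvx.trans (map_zero g)))
      exact ⟨m, rfl⟩
    · rintro ⟨m, hm⟩
      exact (congrArg (fun e => e.1.2) hm).symm
  mul_incl := by
    rintro ⟨⟨v, x⟩, hvx⟩ m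
    exact Subtype.ext (Prod.ext (incl_smul (ncAbLift_mk hvx) m).symm (mul_zero x))
  incl_mul := by
    rintro ⟨⟨v, x⟩, hvx⟩ m
    exact Subtype.ext (Prod.ext
      ((incl_mul m v).trans (incl_smul (ncAbLift_mk hvx) m).symm) (zero_mul x))

end TopPiece

theorem exists_algHom_comp_eq_of_sub_mem {Λ' E : Type u} [Ring Λ'] [Algebra ℂ Λ'] [Ring E]
    [Algebra ℂ E] [Algebra.FormallySmooth ℂ (NCAb E)] (hΛ' : IsNCNilpotent (d + 1) Λ')
    (hΛ : IsNCNilpotent (d + 1) Λ) {p : Λ' →ₐ[ℂ] Λ} (hp : Function.Surjective p) {f : E →ₐ[ℂ] Λ}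
    {g : E →ₐ[ℂ] Λ'} (hfg : ∀ e, f e - p (g e) ∈ ncFiltration Λ (d + 1)) :
    ∃ g' : E →ₐ[ℂ] Λ', p.comp g' = f := by
  have hρ : (NCAb.map p).comp (NCAb.map g) = NCAb.map (p.comp g) := AlgHom.ext fun a => by
    obtain ⟨e, rfl⟩ := NCAb.mk_surjective a
    rfl
  have hfg' : ∀ e, f e - p.comp g e ∈ ncFiltration Λ (d + 1) := hfg
  obtain ⟨D, hD⟩ := exists_derivation_lift (TopPiece.map (hΛ := hΛ) (hΛ' := hΛ') p hρ)
    (TopPiece.map_surjective hρ hp) (TopPiece.derivationOfSub f (p.comp g) hfg')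
  refine ⟨TopPiece.algHomAdd g D, AlgHom.ext fun e => ?_⟩
  have hDe := congrArg (TopPiece.incl hΛ (NCAb.map (p.comp g))) (hD (NCAb.mk E e))
  rw [TopPiece.incl_map, TopPiece.incl_derivationOfSub] at hDe
  rw [AlgHom.comp_apply, TopPiece.algHomAdd_apply, map_add, hDe, AlgHom.comp_apply, add_sub_cancel]

end TopPiece

section Smoothness

variable {R E : Type u} [Ring R] [Algebra ℂ R] [Ring E] [Algebra ℂ E]
  {X : CentralExtension R (HochschildH2 R) E} {d : ℕ}

namespace CentralExtension

theorem IsUniversal.exists_algHom_lift [Algebra.FormallySmooth ℂ (NCAb R)] (hX : X.IsUniversal)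
    {Λ : Type u} [Ring Λ] [Algebra ℂ Λ] (hΛ : IsNCNilpotent (d + 1) Λ)
    (g : R →ₐ[ℂ] Λ ⧸ ncFiltration Λ (d + 1)) :
    ∃ G : E →ₐ[ℂ] Λ, ∀ e, Ideal.Quotient.mkₐ ℂ (ncFiltration Λ (d + 1)) (G e) = g (X.proj e) := by
  obtain ⟨G, hG⟩ := hX.exists_algHom (TopPiece.pullback hΛ g)
  refine ⟨(AlgHom.fst ℂ Λ R).comp ((TopPiece.pullbackAlgebra g).val.comp G), fun e => ?_⟩
  rw [← hG]
  exact (G e).2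

end CentralExtension

/-- The homomorphism `Λ'/F^dΛ' → Λ/F^dΛ` induced by a homomorphism `Λ' → Λ`. -/
def ncQuotientMap {Λ' Λ : Type u} [Ring Λ'] [Algebra ℂ Λ'] [Ring Λ] [Algebra ℂ Λ] (d : ℕ)
    (p : Λ' →ₐ[ℂ] Λ) : Λ' ⧸ ncFiltration Λ' d →ₐ[ℂ] Λ ⧸ ncFiltration Λ d :=
  Ideal.quotientMapₐ (ncFiltration Λ d) p fun _ => map_mem_ncFiltration p

theorem isNilpotent_ker_ncQuotientMap {Λ' Λ : Type u} [Ring Λ'] [Algebra ℂ Λ'] [Ring Λ]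
    [Algebra ℂ Λ] {p : Λ' →ₐ[ℂ] Λ} (hp : Function.Surjective p)
    (hker : IsNilpotent (RingHom.ker p)) (d : ℕ) :
    IsNilpotent (RingHom.ker (ncQuotientMap d p)) := by
  let q := Ideal.Quotient.mk (ncFiltration Λ' d)
  refine isNilpotent_of_le (fun y hy => ?_)
    (isNilpotent_map_of_surjective (f := q) Ideal.Quotient.mk_surjective hker)
  obtain ⟨x, rfl⟩ := Ideal.Quotient.mk_surjective y
  obtain ⟨z, hz, hzx : p z = p x⟩ :=
    exists_mem_ncFiltration_of_surjective p hp (Ideal.Quotient.eq_zero_iff_mem.1 hy)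
  have hx : q x = q (x - z) := by
    rw [map_sub, Ideal.Quotient.eq_zero_iff_mem.2 hz, sub_zero]
  rw [hx]
  exact Ideal.mem_map_of_mem q (by rw [RingHom.mem_ker, map_sub, hzx, sub_self])

theorem exists_algHom_comp_eq_of_ker_le {k A B C : Type*} [CommSemiring k] [Ring A] [Algebra k A]
    [Ring B] [Algebra k B] [Semiring C] [Algebra k C] {p : A →ₐ[k] B}
    (hp : Function.Surjective p) {f : A →ₐ[k] C} (hf : RingHom.ker p ≤ RingHom.ker f) :
    ∃ g : B →ₐ[k] C, g.comp p = f := by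
  refine ⟨(Ideal.Quotient.liftₐ (RingHom.ker p) f hf).comp
    (Ideal.quotientKerAlgEquivOfSurjective hp).symm.toAlgHom, AlgHom.ext fun x => ?_⟩
  change Ideal.Quotient.liftₐ (RingHom.ker p) f hf
    ((Ideal.quotientKerAlgEquivOfSurjective hp).symm (p x)) = f x
  rw [Ideal.quotientKerAlgEquivOfSurjective_symm_apply]
  rfl

namespace CentralExtension

theorem IsUniversal.formallySmooth_ncAb (hR : IsDSmooth d R) (hX : X.IsUniversal) :
    Algebra.FormallySmooth ℂ (NCAb E) := by
  obtain ⟨ψ, -⟩ := hX.exists_ncAb_equiv hR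
  have := hR.formallySmooth_ncAb
  exact Algebra.FormallySmooth.of_equiv ψ.symm

theorem IsUniversal.isFormallyNCSmooth (hR : IsDSmooth d R) (hX : X.IsUniversal) :
    IsFormallyNCSmooth (d + 1) E := by
  intro Λ' Λ _ _ _ _ hΛ' hΛ p hp hker f
  let q := Ideal.Quotient.mkₐ ℂ (ncFiltration Λ (d + 1))
  obtain ⟨fbar, hfbar⟩ := exists_algHom_comp_eq_of_ker_le X.proj_surjective (f := q.comp f)
    fun e he => Ideal.Quotient.eq_zero_iff_mem.2 (map_mem_ncFiltration f (hX.ker_proj_le hR he))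
  obtain ⟨gbar, hgbar⟩ := hR.formallySmooth _ _ (isNCNilpotent_quotient d)
    (isNCNilpotent_quotient d) (ncQuotientMap (d + 1) p)
    (Ideal.quotientMap_surjective (H := fun _ => map_mem_ncFiltration p) hp)
    (isNilpotent_ker_ncQuotientMap hp hker (d + 1)) fbar
  have := hR.formallySmooth_ncAb
  have := hX.formallySmooth_ncAb hR
  obtain ⟨g, hg⟩ := hX.exists_algHom_lift hΛ' gbar
  refine exists_algHom_comp_eq_of_sub_mem hΛ' hΛ hp (g := g) fun e => ?_
  have hpg : q (p (g e)) = fbar (X.proj e) := by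
    rw [← hgbar, AlgHom.comp_apply, ← hg]
    rfl
  rw [← Ideal.Quotient.eq, ← Ideal.Quotient.mkₐ_eq_mk ℂ, hpg]
  exact (DFunLike.congr_fun hfbar e).symm

theorem IsUniversal.isDSmooth (hR : IsDSmooth d R) (hX : X.IsUniversal) :
    IsDSmooth (d + 1) E where
  finiteType := by
    obtain ⟨ψ, -⟩ := hX.exists_ncAb_equiv hR
    have := hR.finiteType
    have : Algebra.FiniteType ℂ (NCAb R) :=
      Algebra.FiniteType.of_surjective (NCAb.mk R) NCAb.mk_surjective
    exact (X.isNCNilpotent hR.ncNilpotent).finiteType (this.equiv ψ.symm)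
  ncNilpotent := X.isNCNilpotent hR.ncNilpotent
  formallySmooth := hX.isFormallyNCSmooth hR

end CentralExtension

end Smoothness

section Thickenings

variable (A : Type u) [CommRing A] [Algebra ℂ A] [Algebra.Smooth ℂ A]

/-- The trivial thickening of a smooth commutative algebra. -/
noncomputable def DSmoothThickening.self : DSmoothThickening 0 A A where
  dSmooth := isDSmooth_zero_of_smooth A
  iso := (AlgEquiv.ofBijective (NCAb.mk A) ⟨(injective_iff_map_eq_zero _).2 fun _ hx =>
    (isNCNilpotent_of_commRing A 0).eq_zero le_rfl (NCAb.mk_eq_zero.1 hx),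
    NCAb.mk_surjective⟩).symm

theorem exists_dSmoothThickening (d : ℕ) :
    ∃ (R : Type u) (_ : Ring R) (_ : Algebra ℂ R), Nonempty (DSmoothThickening d A R) := by
  induction d with
  | zero => exact ⟨A, inferInstance, inferInstance, ⟨DSmoothThickening.self A⟩⟩
  | succ d ih =>
    obtain ⟨R, _, _, ⟨T⟩⟩ := ih
    have := T.dSmooth.formallySmooth_ncAb
    obtain ⟨E, _, _, X, hX⟩ := exists_isUniversal R
    obtain ⟨ψ, -⟩ := hX.exists_ncAb_equiv T.dSmooth
    exact ⟨E, inferInstance, inferInstance, ⟨hX.isDSmooth T.dSmooth, ψ.trans T.iso⟩⟩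

end Thickenings

section Generators

variable {R : Type*} [Ring R] [Algebra ℂ R] {ι : Type*} {x : ι → R}

theorem commutator_mem_of_adjoin_eq_top (hx : Algebra.adjoin ℂ (Set.range x) = ⊤) {I : Ideal R}
    [I.IsTwoSided] {S : Submodule ℂ R} (h : ∀ i, ∀ u ∈ I, x i * u - u * x i ∈ S) (r : R) :
    ∀ u ∈ I, r * u - u * r ∈ S := by
  have hr : r ∈ Algebra.adjoin ℂ (Set.range x) := by rw [hx]; trivial
  induction hr using Algebra.adjoin_induction with
  | mem r hr =>
    obtain ⟨i, rfl⟩ := hr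
    exact h i
  | algebraMap c =>
    intro u _
    rw [Algebra.commutes, sub_self]
    exact zero_mem _
  | add a b _ _ ha hb =>
    intro u hu
    have hsplit : (a + b) * u - u * (a + b) = (a * u - u * a) + (b * u - u * b) := by noncomm_ring
    exact hsplit ▸ add_mem (ha u hu) (hb u hu)
  | mul a b _ _ ha hb =>
    intro u hu
    have hsplit : a * b * u - u * (a * b) =
        (a * (b * u) - b * u * a) + (b * (u * a) - u * a * b) := by noncomm_ring
    exact hsplit ▸ add_mem (ha _ (I.mul_mem_left b hu)) (hb _ (I.mul_mem_right a hu))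

theorem ncFiltration_one_le_of_adjoin_eq_top (hx : Algebra.adjoin ℂ (Set.range x) = ⊤) {J : Ideal R}
    [J.IsTwoSided] (hJ : ∀ i j, x i * x j - x j * x i ∈ J) : ncFiltration R 1 ≤ J := by
  let q := Ideal.Quotient.mkₐ ℂ J
  have hq (r : R) : q r ∈ Algebra.adjoin ℂ (Set.range (q ∘ x)) := by
    rw [Set.range_comp, ← AlgHom.map_adjoin, hx]
    exact ⟨r, trivial, rfl⟩
  have hgen (i j : ι) : Commute (q (x i)) (q (x j)) := by
    change q (x i) * q (x j) = q (x j) * q (x i)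
    rw [← map_mul, ← map_mul]
    exact Ideal.Quotient.eq.2 (hJ i j)
  have hcomm (a b : R) : Commute (q a) (q b) :=
    Algebra.commute_of_mem_adjoin_of_forall_mem_commute (hq b) <| Set.forall_mem_range.2 fun j =>
      (Algebra.commute_of_mem_adjoin_of_forall_mem_commute (hq a) <|
        Set.forall_mem_range.2 fun i => hgen j i).symm
  refine ncFiltration_one_le fun a b => Ideal.Quotient.eq.1 ?_
  exact (map_mul q a b).trans ((hcomm a b).eq.trans (map_mul q b a).symm)

theorem mul_mem_of_adjoin_eq_top (hx : Algebra.adjoin ℂ (Set.range x) = ⊤) {n : ℕ}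
    {S : Submodule ℂ R} (hmul : ∀ i j, ∀ u ∈ ncFiltration R n, (x i * x j - x j * x i) * u ∈ S)
    (htop : ncFiltrationSubmodule R (n + 2) ≤ S) :
    ∀ v ∈ ncFiltration R 1, ∀ u ∈ ncFiltration R n, v * u ∈ S := by
  let J : Ideal R :=
    { carrier := {v | v ∈ ncFiltration R 1 ∧ ∀ u ∈ ncFiltration R n, v * u ∈ S}
      add_mem' := fun ha hb => ⟨add_mem ha.1 hb.1, fun u hu => by
        rw [add_mul]
        exact add_mem (ha.2 u hu) (hb.2 u hu)⟩
      zero_mem' := ⟨zero_mem _, fun u _ => by simp⟩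
      smul_mem' := fun r v hv => ⟨Ideal.mul_mem_left _ r hv.1, fun u hu => by
        have hsplit : r * v * u = (r * v - v * r) * u + v * (r * u) := by noncomm_ring
        have hdeg : (r * v - v * r) * u ∈ ncFiltration R (n + 2) :=
          add_comm n 2 ▸ mul_mem_ncFiltration (commutator_mem_ncFiltration_succ r hv.1) hu
        exact hsplit ▸ add_mem (htop hdeg) (hv.2 _ (Ideal.mul_mem_left _ r hu))⟩ }
  have : J.IsTwoSided := ⟨fun {v} r hv => ⟨Ideal.mul_mem_right r _ hv.1, fun u hu => by
    rw [mul_assoc]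
    exact hv.2 _ (Ideal.mul_mem_left _ r hu)⟩⟩
  have hJ : ncFiltration R 1 ≤ J := ncFiltration_one_le_of_adjoin_eq_top hx fun i j =>
    ⟨commutator_mem_ncFiltration_one R _ _, hmul i j⟩
  exact fun v hv => (hJ hv).2

/-- The operators `[xᵢ, -]` and `[xᵢ, xⱼ] -` attached to a family of elements. They raise the degree
of an NC-filtration by one. -/
def commutatorOperator (x : ι → R) : ι ⊕ ι × ι → R →ₗ[ℂ] R
  | .inl i => LinearMap.mulLeft ℂ (x i) - LinearMap.mulRight ℂ (x i)
  | .inr (i, j) => LinearMap.mulLeft ℂ (x i * x j - x j * x i)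

theorem IsNCFiltration.commutatorOperator_mem {G : ℕ → Submodule ℂ R} (hG : IsNCFiltration G)
    (x : ι → R) (k : ι ⊕ ι × ι) {n : ℕ} {z : R} (hz : z ∈ G n) :
    commutatorOperator x k z ∈ G (n + 1) :=
  match k with
  | .inl i => hG.commutator_mem (x i) hz
  | .inr (i, j) => add_comm 1 n ▸
    hG.mul_mem (hG.commutator_mem (x i) (hG.zero ▸ Submodule.mem_top : x j ∈ G 0)) hz

variable [Fintype ι]

/-- The sum `(z_k) ↦ ∑ₖ Dₖ z_k` of the operators `Dₖ` of `commutatorOperator`. -/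
noncomputable def commutatorSum (x : ι → R) : (ι ⊕ ι × ι → R) →ₗ[ℂ] R :=
  ∑ k, (commutatorOperator x k).comp (LinearMap.proj k)

theorem commutatorSum_apply (x : ι → R) (z : ι ⊕ ι × ι → R) :
    commutatorSum x z = ∑ k, commutatorOperator x k (z k) := by
  simp [commutatorSum]

theorem map_commutatorSum {S : Type*} [Ring S] [Algebra ℂ S] (f : R →ₐ[ℂ] S) (x : ι → R)
    (z : ι ⊕ ι × ι → R) : f (commutatorSum x z) = commutatorSum (f ∘ x) (f ∘ z) := by
  simp [commutatorSum_apply, commutatorOperator]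

theorem IsNCFiltration.commutatorSum_mem {G : ℕ → Submodule ℂ R} (hG : IsNCFiltration G)
    (x : ι → R) {n : ℕ} {z : ι ⊕ ι × ι → R} (hz : ∀ k, z k ∈ G n) :
    commutatorSum x z ∈ G (n + 1) := by
  rw [commutatorSum_apply]
  exact sum_mem fun k _ => hG.commutatorOperator_mem x k (hz k)

theorem exists_sub_commutatorSum_mem (hx : Algebra.adjoin ℂ (Set.range x) = ⊤) {n : ℕ} {y : R}
    (hy : y ∈ ncFiltration R (n + 1)) :
    ∃ z : ι ⊕ ι × ι → R, (∀ k, z k ∈ ncFiltration R n) ∧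
      y - commutatorSum x z ∈ ncFiltration R (n + 2) := by
  classical
  let S : Submodule ℂ R := (Submodule.pi Set.univ fun _ => ncFiltrationSubmodule R n).map
    (commutatorSum x) ⊔ ncFiltrationSubmodule R (n + 2)
  have hop (k : ι ⊕ ι × ι) (u : R) (hu : u ∈ ncFiltration R n) : commutatorOperator x k u ∈ S := by
    refine Submodule.mem_sup_left ⟨Pi.single k u, fun j _ => ?_, ?_⟩
    · obtain rfl | hj := eq_or_ne j k
      · rwa [Pi.single_eq_same]
      · simp [hj]
    · rw [commutatorSum_apply, Finset.sum_eq_single_of_mem k (Finset.mem_univ k) fun j _ hj => by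
        rw [Pi.single_eq_of_ne hj, map_zero], Pi.single_eq_same]
  have hyS : y ∈ S := mem_of_mem_ncFiltration_succ
    (commutator_mem_of_adjoin_eq_top hx fun i => hop (.inl i))
    (mul_mem_of_adjoin_eq_top hx (fun i j => hop (.inr (i, j))) le_sup_right) hy
  obtain ⟨_, ⟨z, hz, rfl⟩, u, hu, rfl⟩ := Submodule.mem_sup.1 hyS
  exact ⟨z, fun k => hz k trivial, by rwa [add_sub_cancel_left]⟩

end Generators

section InverseLimit

theorem exists_compatible_extension (d : ℕ) {V : ℕ → Type*} (π : ∀ n, V (n + 1) → V n)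
    (hπ : ∀ n, Function.Surjective (π n)) (y : V d) :
    ∃ x : ∀ n, V n, (∀ n, π n (x (n + 1)) = x n) ∧ x d = y := by
  induction d generalizing V with
  | zero =>
    choose s hs using hπ
    exact ⟨fun n => Nat.rec y (fun n v => s n v) n, fun n => hs n _, rfl⟩
  | succ d ih =>
    obtain ⟨x, hx, hxd⟩ := ih (V := fun n => V (n + 1)) (fun n => π (n + 1)) (fun n => hπ (n + 1)) y
    refine ⟨fun n => Nat.casesOn n (π 0 (x 0)) x, fun n => ?_, hxd⟩
    cases n with
    | zero => rfl
    | succ n => exact hx n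

variable {V : ℕ → Type u} [∀ n, Ring (V n)] [∀ n, Algebra ℂ (V n)]

/-- The inverse limit of a tower of algebras, as the algebra of compatible sequences. -/
def towerLimit (π : ∀ n, V (n + 1) →ₐ[ℂ] V n) : Subalgebra ℂ (∀ n, V n) where
  carrier := {x | ∀ n, π n (x (n + 1)) = x n}
  mul_mem' := fun hx hy n => by rw [Pi.mul_apply, map_mul, hx n, hy n, Pi.mul_apply]
  add_mem' := fun hx hy n => by rw [Pi.add_apply, map_add, hx n, hy n, Pi.add_apply]
  algebraMap_mem' := fun c n => by
    rw [Pi.algebraMap_apply, AlgHom.commutes, Pi.algebraMap_apply]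

/-- A tower of surjections of NC-nilpotent algebras, each of which is the largest quotient of the
next one that is NC-nilpotent of the given degree, with finitely generated bottom. -/
structure IsNCTower (π : ∀ n, V (n + 1) →ₐ[ℂ] V n) : Prop where
  surjective : ∀ n, Function.Surjective (π n)
  nilpotent : ∀ n, IsNCNilpotent n (V n)
  ker_le : ∀ n, RingHom.ker (π n) ≤ ncFiltration (V (n + 1)) (n + 1)
  finiteType : Algebra.FiniteType ℂ (V 0)

namespace towerLimit

variable {π : ∀ n, V (n + 1) →ₐ[ℂ] V n}

variable (π) in
/-- The projection of the inverse limit of a tower to its `n`-th term. -/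
def proj (n : ℕ) : towerLimit π →ₐ[ℂ] V n := (Pi.evalAlgHom ℂ V n).comp (towerLimit π).val

theorem map_proj (x : towerLimit π) (n : ℕ) : π n (proj π (n + 1) x) = proj π n x := x.2 n

theorem ext_proj {x y : towerLimit π} (h : ∀ n, proj π n x = proj π n y) : x = y :=
  Subtype.ext (funext h)

theorem proj_surjective (h : IsNCTower π) (n : ℕ) : Function.Surjective (proj π n) := fun y => by
  obtain ⟨x, hx, hxy⟩ := exists_compatible_extension n (fun n => π n) h.surjective y
  exact ⟨⟨x, hx⟩, hxy⟩

variable (π) in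
/-- The filtration of the inverse limit of a tower by the elements all of whose components lie in
the given term of the NC-filtration. -/
def closedFiltration (n : ℕ) : Submodule ℂ (towerLimit π) :=
  ⨅ m, (ncFiltrationSubmodule (V m) n).comap (proj π m).toLinearMap

theorem mem_closedFiltration {n : ℕ} {x : towerLimit π} :
    x ∈ closedFiltration π n ↔ ∀ m, proj π m x ∈ ncFiltration (V m) n := by
  simp only [closedFiltration, Submodule.mem_iInf, Submodule.mem_comap]
  rfl

theorem isNCFiltration_closedFiltration : IsNCFiltration (closedFiltration π) where
  zero := top_le_iff.1 fun _ _ => mem_closedFiltration.2 fun _ => mem_ncFiltration_zero _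
  mul_mem i j x y hx hy := mem_closedFiltration.2 fun m => by
    rw [map_mul]
    exact mul_mem_ncFiltration (mem_closedFiltration.1 hx m) (mem_closedFiltration.1 hy m)
  commutator_mem i x y hy := mem_closedFiltration.2 fun m => by
    rw [map_sub, map_mul, map_mul]
    exact commutator_mem_ncFiltration_succ _ (mem_closedFiltration.1 hy m)

theorem mem_closedFiltration_of_proj_mem (h : IsNCTower π) {m n : ℕ} (hn : n ≤ m + 1)
    {x : towerLimit π} (hx : proj π m x ∈ ncFiltration (V m) n) : x ∈ closedFiltration π n := by
  refine mem_closedFiltration.2 fun k => ?_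
  rcases le_total k m with hk | hk
  · refine Nat.decreasingInduction' (fun j _ _ hj => ?_) hk hx
    rw [← map_proj]
    exact map_mem_ncFiltration (π j) hj
  · induction k, hk using Nat.le_induction with
    | base => exact hx
    | succ k hk ih =>
      rw [← map_proj] at ih
      obtain ⟨y, hy, hyx⟩ := exists_mem_ncFiltration_of_surjective (π k) (h.surjective k) ih
      have hdiff : proj π (k + 1) x - y ∈ ncFiltration (V (k + 1)) (k + 1) :=
        h.ker_le k (by rw [RingHom.mem_ker, map_sub]; exact sub_eq_zero.2 hyx.symm)
      rw [← sub_add_cancel (proj π (k + 1) x) y]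
      exact add_mem (ncFiltration_antitone (by omega) hdiff) hy

theorem proj_eq_zero_iff_mem_closedFiltration (h : IsNCTower π) {m : ℕ} {x : towerLimit π} :
    proj π m x = 0 ↔ x ∈ closedFiltration π (m + 1) :=
  ⟨fun hx => mem_closedFiltration_of_proj_mem h le_rfl (by rw [hx]; exact zero_mem _),
    fun hx => (h.nilpotent m).eq_zero le_rfl (mem_closedFiltration.1 hx m)⟩

theorem isCompleteFiltration_closedFiltration (h : IsNCTower π) :
    IsCompleteFiltration (closedFiltration π) := by
  have hanti : Antitone (closedFiltration π) := fun _ _ hij _ hx =>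
    mem_closedFiltration.2 fun m => ncFiltration_antitone hij (mem_closedFiltration.1 hx m)
  refine ⟨hanti, fun x hx => ext_proj fun m => ?_, fun x hx => ?_⟩
  · rw [(proj_eq_zero_iff_mem_closedFiltration h).2 (hx (m + 1)), map_zero]
  · let y : towerLimit π := ⟨fun m => proj π m (x (m + 1)), fun m => by
      rw [map_proj, ← sub_eq_zero, ← map_sub]
      exact (proj_eq_zero_iff_mem_closedFiltration h).2 (hx (m + 1))⟩
    refine ⟨y, fun n => ?_⟩
    cases n with
    | zero =>
      rw [isNCFiltration_closedFiltration.zero]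
      trivial
    | succ n =>
      exact (proj_eq_zero_iff_mem_closedFiltration h).1 ((map_sub _ _ _).trans (sub_self _))

theorem exists_adjoin_proj_eq_top (h : IsNCTower π) :
    ∃ (ι : Type u) (_ : Fintype ι) (x : ι → towerLimit π),
      ∀ m, Algebra.adjoin ℂ (Set.range (proj π m ∘ x)) = ⊤ := by
  obtain ⟨s, hs⟩ := h.finiteType.out
  choose l hl using proj_surjective h 0
  let B := Algebra.adjoin ℂ (Set.range fun i : s => l i)
  have hB : B.map (proj π 0) = ⊤ := by
    rw [AlgHom.map_adjoin, ← Set.range_comp, ← hs]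
    congr
    simp [Function.comp_def, hl]
  refine ⟨s, inferInstance, fun i => l i, fun m => ?_⟩
  rw [Set.range_comp, ← AlgHom.map_adjoin]
  refine (h.nilpotent m).eq_top_of_map_mk_eq_top (top_le_iff.1 fun v _ => ?_)
  obtain ⟨v, rfl⟩ := NCAb.mk_surjective v
  obtain ⟨y, rfl⟩ := proj_surjective h m v
  obtain ⟨b, hb, hby : proj π 0 b = proj π 0 y⟩ := hB.ge (Algebra.mem_top (x := proj π 0 y))
  have hdiff : b - y ∈ closedFiltration π 1 :=
    (proj_eq_zero_iff_mem_closedFiltration h).1 (by rw [map_sub, hby, sub_self])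
  refine ⟨_, ⟨b, hb, rfl⟩, NCAb.mk_eq_mk.2 ?_⟩
  have hproj := mem_closedFiltration.1 hdiff m
  rwa [map_sub] at hproj

theorem exists_sub_commutatorSum_mem_closedFiltration (h : IsNCTower π) {ι : Type*} [Fintype ι]
    {x : ι → towerLimit π} (hx : ∀ m, Algebra.adjoin ℂ (Set.range (proj π m ∘ x)) = ⊤) {m : ℕ}
    {y : towerLimit π} (hy : y ∈ closedFiltration π (m + 1)) :
    ∃ z : ι ⊕ ι × ι → towerLimit π, (∀ k, z k ∈ closedFiltration π m) ∧
      y - commutatorSum x z ∈ closedFiltration π (m + 2) := by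
  obtain ⟨z, hz, hyz⟩ :=
    exists_sub_commutatorSum_mem (hx (m + 1)) (mem_closedFiltration.1 hy (m + 1))
  choose w hw using fun k => proj_surjective h (m + 1) (z k)
  obtain rfl : proj π (m + 1) ∘ w = z := funext hw
  refine ⟨w, fun k => mem_closedFiltration_of_proj_mem h (by omega) (hz k),
    mem_closedFiltration_of_proj_mem h le_rfl ?_⟩
  rwa [map_sub, map_commutatorSum]

theorem closedFiltration_eq_ncFiltrationSubmodule (h : IsNCTower π) (n : ℕ) :
    closedFiltration π n = ncFiltrationSubmodule (towerLimit π) n := by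
  refine le_antisymm ?_ fun y hy => isNCFiltration_closedFiltration.mem_of_mem_ncFiltration hy
  obtain ⟨ι, _, x, hx⟩ := exists_adjoin_proj_eq_top h
  have hcomplete := isCompleteFiltration_closedFiltration h
  induction n with
  | zero => exact fun y _ => mem_ncFiltration_zero y
  | succ n ih =>
    intro y hy
    have htail := (hcomplete.shift (n + 1)).eq_zero
    obtain ⟨z, hz, rfl⟩ := ((hcomplete.shift n).pi (ι ⊕ ι × ι)).exists_map_eq htail
      (commutatorSum x)
      (fun m z hz => by
        rw [add_right_comm]
        exact isNCFiltration_closedFiltration.commutatorSum_mem x fun k => hz k trivial)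
      (fun m y hy => by
        rw [add_right_comm] at hy
        obtain ⟨z, hz, hyz⟩ := exists_sub_commutatorSum_mem_closedFiltration h hx hy
        exact ⟨z, fun k _ => hz k, by convert hyz using 2; omega⟩)
      hy
    exact isNCFiltration_ncFiltrationSubmodule.commutatorSum_mem x fun k => ih (hz k trivial)

theorem proj_eq_zero_iff (h : IsNCTower π) {n : ℕ} {y : towerLimit π} :
    proj π n y = 0 ↔ y ∈ ncFiltration (towerLimit π) (n + 1) := by
  rw [proj_eq_zero_iff_mem_closedFiltration h, closedFiltration_eq_ncFiltrationSubmodule h]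
  rfl

theorem exists_quotient_equiv (h : IsNCTower π) (n : ℕ) :
    Nonempty ((towerLimit π ⧸ ncFiltration (towerLimit π) (n + 1)) ≃ₐ[ℂ] V n) := by
  have hker : RingHom.ker (proj π n) = ncFiltration (towerLimit π) (n + 1) :=
    Ideal.ext fun _ => proj_eq_zero_iff h
  exact ⟨(Ideal.quotientEquivAlgOfEq ℂ hker.symm).trans
    (Ideal.quotientKerAlgEquivOfSurjective (proj_surjective h n))⟩

theorem isNCComplete (h : IsNCTower π) : IsNCComplete (towerLimit π) := by
  rw [isNCComplete_iff, ← funext (closedFiltration_eq_ncFiltrationSubmodule h)]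
  exact isCompleteFiltration_closedFiltration h

end towerLimit

end InverseLimit

section Existence

theorem DSmoothThickening.exists_quotientMap {A : Type u} [CommRing A] [Algebra ℂ A]
    {R R' : Type u} [Ring R] [Algebra ℂ R] [Ring R'] [Algebra ℂ R'] {d : ℕ}
    (T : DSmoothThickening (d + 1) A R) (T' : DSmoothThickening d A R') :
    ∃ f : R →ₐ[ℂ] R', Function.Surjective f ∧ RingHom.ker f ≤ ncFiltration R (d + 1) := by
  let q := Ideal.Quotient.mkₐ ℂ (ncFiltration R (d + 1))
  have hq : Function.Surjective q := Ideal.Quotient.mkₐ_surjective _ _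
  have hker : RingHom.ker q = ncFiltration R (d + 1) := Ideal.mk_ker
  let ψ := AlgEquiv.ofBijective (NCAb.map q)
    (NCAb.map_bijective q hq (hker.trans_le (ncFiltration_antitone (Nat.le_add_left 1 d))))
  let T₁ : DSmoothThickening d A (R ⧸ ncFiltration R (d + 1)) :=
    ⟨T.dSmooth.quotient (Nat.le_succ d), ψ.symm.trans T.iso⟩
  obtain ⟨e, -⟩ := T₁.exists_algEquiv T'
  refine ⟨e.toAlgHom.comp q, e.surjective.comp hq, fun x hx => hker.le ?_⟩
  exact e.injective (hx.trans (map_zero e).symm)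

theorem exists_ncSmoothThickening (A : Type u) [CommRing A] [Algebra ℂ A] [Algebra.Smooth ℂ A] :
    ∃ (R : Type u) (_ : Ring R) (_ : Algebra ℂ R), Nonempty (NCSmoothThickening A R) := by
  choose V _ _ hT using exists_dSmoothThickening A
  let T : ∀ d, DSmoothThickening d A (V d) := fun d => (hT d).some
  choose π hπ hker using fun d => (T (d + 1)).exists_quotientMap (T d)
  have h : IsNCTower π := ⟨hπ, fun n => (T n).dSmooth.ncNilpotent, hker, (T 0).dSmooth.finiteType⟩
  let ψ := AlgEquiv.ofBijective (NCAb.map (towerLimit.proj π 0)) <|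
    NCAb.map_bijective _ (towerLimit.proj_surjective h 0) fun _ => (towerLimit.proj_eq_zero_iff h).1
  refine ⟨towerLimit π, inferInstance, inferInstance,
    ⟨⟨towerLimit.isNCComplete h, fun d => ?_⟩, ψ.trans (T 0).iso⟩⟩
  obtain ⟨e⟩ := towerLimit.exists_quotient_equiv h d
  exact (T d).dSmooth.of_equiv e.symm

end Existence

theorem theorem1p6p1 :
    -- existence and uniqueness of thickenings of smooth commutative algebras
    (∀ (A : Type u) [CommRing A] [Algebra ℂ A] [Algebra.Smooth ℂ A],
      (∀ d : ℕ,
        (∃ (R : Type u) (_ : Ring R) (_ : Algebra ℂ R), Nonempty (DSmoothThickening d A R)) ∧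
        ∀ (R R' : Type u) [Ring R] [Algebra ℂ R] [Ring R'] [Algebra ℂ R']
          (T : DSmoothThickening d A R) (T' : DSmoothThickening d A R'),
          ∃ φ : R ≃ₐ[ℂ] R', ∀ x : R, T'.iso (NCAb.mk R' (φ x)) = T.iso (NCAb.mk R x)) ∧
      (∃ (R : Type u) (_ : Ring R) (_ : Algebra ℂ R), Nonempty (NCSmoothThickening A R)) ∧
      (∀ (R R' : Type u) [Ring R] [Algebra ℂ R] [Ring R'] [Algebra ℂ R']
        (T : NCSmoothThickening A R) (T' : NCSmoothThickening A R'),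
        ∃ φ : R ≃ₐ[ℂ] R', ∀ x : R, T'.iso (NCAb.mk R' (φ x)) = T.iso (NCAb.mk R x))) ∧
    -- the universal central extension of a `d`-smooth algebra exists, is `(d+1)`-smooth
    -- and has the same commutativization
    (∀ (d : ℕ) (R : Type u) [Ring R] [Algebra ℂ R], IsDSmooth d R →
      (∃ (E : Type u) (_ : Ring E) (_ : Algebra ℂ E)
        (X : CentralExtension R (HochschildH2 R) E), X.IsUniversal) ∧
      ∀ (E : Type u) [Ring E] [Algebra ℂ E] (X : CentralExtension R (HochschildH2 R) E),
        X.IsUniversal →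
        IsDSmooth (d + 1) E ∧
        ∃ ψ : NCAb E ≃ₐ[ℂ] NCAb R, ∀ x : E, ψ (NCAb.mk E x) = NCAb.mk R (X.proj x)) := by
  refine ⟨fun A _ _ _ => ⟨fun d => ⟨exists_dSmoothThickening A d, fun R R' _ _ _ _ T T' =>
    T.exists_algEquiv T'⟩, exists_ncSmoothThickening A, fun R R' _ _ _ _ T T' =>
    T.exists_algEquiv T'⟩, fun d R _ _ hR => ⟨?_, fun E _ _ X hX =>
    ⟨hX.isDSmooth hR, hX.exists_ncAb_equiv hR⟩⟩⟩
  have := hR.formallySmooth_ncAb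
  exact exists_isUniversal R
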